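/- **Setting.** Let $n\ge 1$, $d\ge 8$ (so that $q$ below satisfies $1<q\le 2$), $x_1,\dots,x_n\in\mathbb R^d$, and let $\phi_1,\dots,\phi_n:\mathbb R\to\mathbb R$ be convex with $\phi_i\ge 0$ and $\frac1n\sum_i\phi_i(0)\le 1$. Let $\sigma,\epsilon,B>0$, $R\ge\max_i\|x_i\|_\infty$ (e.g. equality), put $$F(w)=\frac1n\sum_{i=1}^n\phi_i(x_i^\top w)+\sigma\|w\|_1 ,$$ and let $w^*$ be a minimizer of $F$ over $\mathbb R^d$ with $\|w^*\|_1\le B$. Put $$\lambda=\frac{\epsilon}{3\log(d)B^2},\qquad q=\frac{\log d}{\log d-1},\qquad g(w)=\frac{3\log d}{2}\|w\|_q^2+\frac{\sigma}{\lambda}\|w\|_1 .$$ Let $\phi_i^*,g^*$ be the convex conjugates ($\phi_i^*$ may be $+\infty$), and for $\alpha\in\mathbb R^n$ let $v(\alpha)=\frac1{\lambda n}\sum_i\alpha_ix_i$, $w(\alpha)=\nabla g^*(v(\alpha))$, $D(\alpha)=\frac1n\sum_i-\phi_i^*(-\alpha_i)-\lambda g^*(v(\alpha))$. Let $\|\cdot\|_{D'}=\kappa\|\cdot\|_\infty$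 and $\bar R=\kappa R$ with the absolute constant $\kappa=e/\sqrt3$. **Prox-SDCA.** The parameter $\gamma$ is $>0$ for $(1/\gamma)$-smooth losses and $0$ for $L$-Lipschitz losses. Start with $\alpha^{(0)}=0$. At iteration $t=1,2,\dots$ draw $i$ uniformly from $\{1,\dots,n\}$, independently of the past, and replace $\alpha_i$, where $\alpha=\alpha^{(t-1)}$ and $w=w(\alpha)$, by $\alpha_i+\Delta$, where $\Delta$ is given by one of the following options, or is any increment whose dual objective $D$ is at least that of one of them (the choices may depend on the history): * (I) $\Delta\in\arg\max_\Delta\big[-\phi_i^*(-(\alpha_i+\Delta))-w^\top x_i\Delta-\frac1{2\lambda n}\|\Delta x_i\|_{D'}^2\big]$; * (II) $\Delta=sz$ with $z=u-\alpha_i$, $-u\in\partial\phi_i(x_i^\top w)$, where $s$ maximizes the objective of (I) at $\Delta=sz$ over $s\in[0,1]$; * (III) $\Delta=sz$ with $z$ as in (II) and $s=\min\Big\{1,\frac{\phi_i(x_i^\top w)+\phi_i^*(-\alpha_i)+w^\top x_i\alpha_i+\frac\gamma2z^2}{z^2(\gamma+\|x_i\|_{D'}^2/(\lambda n))}\Big\}$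 ($s=1$ if the denominator is $0$); * (IV) as (III) with $\|x_i\|_{D'}^2$ replaced by $\bar R^2$; for $L$-Lipschitz losses, $z^2$ in the formula for $s$ may also be replaced by any $\zeta$ with $z^2\le\zeta\le4L^2$; * (V) (smooth losses only) $\Delta=\frac{\lambda n\gamma}{\bar R^2+\lambda n\gamma}\big(-\phi_i'(x_i^\top w)-\alpha_i\big)$. Write $w^{(t)}=w(\alpha^{(t)})$. For $T_0<T$ the averaging output is $\bar w=\frac1{T-T_0}\sum_{t=T_0+1}^{T}w^{(t-1)}$, and the random output is $\bar w=w^{(t)}$ with $t$ uniform in $\{T_0+1,\dots,T\}$, independent of the run. **Claim.** For $M>0$ write $K(M)=C\,M\,\big(1+\log(1+M/\epsilon)\big)$. There is an absolute constant $C>0$ such that in this setting, for every admissible choice of the updates: 1. If every $\phi_i$ is $(1/\gamma)$-smooth (differentiable with $(1/\gamma)$-Lipschitz derivative), $\gamma>0$, and $M=n+\frac{R^2B^2\log d}{\epsilon\gamma}$, then $\mathbb E[F(w^{(T)})]\le F(w^*)+\epsilon$ for all $T\ge K(M)$; moreover both outputs satisfy $\mathbb E[F(\bar w)]\le F(w^*)+\epsilon$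 whenever $T>T_0\ge K(M)$. 2. If every $\phi_i$ is $L$-Lipschitz, $L\ge0$, and $M=n+\frac{L^2R^2B^2\log d}{\epsilon^2}$, then both outputs satisfy $\mathbb E[F(\bar w)]\le F(w^*)+\epsilon$ whenever $T_0\ge K(M)$ and $T-T_0\ge K(M)$. That is, Prox-SDCA solves the $\ell_1$ problem to expected accuracy $\epsilon$ in $\tilde O\big(n+\frac{R^2B^2\log d}{\epsilon\gamma}\big)$, respectively $\tilde O\big(n+\frac{L^2R^2B^2\log d}{\epsilon^2}\big)$, iterations. -/

import Mathlib

open scoped BigOperators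

noncomputable section

namespace ProxSDCA

abbrev Vec (d : ℕ) := EuclideanSpace ℝ (Fin d)

/-- The `ℓ¹` norm on `ℝᵈ`. -/
def l1 {d : ℕ} (w : Vec d) : ℝ := ∑ j, |w j|

/-- The `ℓ^q` norm on `ℝᵈ`. -/
def lq {d : ℕ} (q : ℝ) (w : Vec d) : ℝ := (∑ j, |w j| ^ q) ^ (1 / q)

/-- The `ℓ^∞` norm on `ℝᵈ` (the norm of `Fin d → ℝ` is the sup norm). -/
def linf {d : ℕ} (w : Vec d) : ℝ := ‖(WithLp.ofLp w : Fin d → ℝ)‖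

/-- Convex conjugate of a scalar loss; it may take the value `⊤`. -/
def conj (φ : ℝ → ℝ) (u : ℝ) : EReal := ⨆ z : ℝ, ((z * u - φ z : ℝ) : EReal)

/-- Convex conjugate of a regularizer on `ℝᵈ` of superlinear growth (so the supremum is finite). -/
def conjVec {d : ℕ} (g : Vec d → ℝ) (v : Vec d) : ℝ := ⨆ w : Vec d, (inner ℝ w v - g w)

/-- `u ∈ ∂φ(a)`. -/
def IsSubgradient (φ : ℝ → ℝ) (a u : ℝ) : Prop := ∀ b, φ a + u * (b - a) ≤ φ b

/-- The two classes of losses: `(1/γ)`-smooth, and `L`-Lipschitz. -/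
inductive LossClass where
  | smooth (γ : ℝ)
  | lipschitz (L : ℝ)

/-- The parameter `γ` handed to the algorithm (`0` for Lipschitz losses). -/
def LossClass.gamma : LossClass → ℝ
  | .smooth γ => γ
  | .lipschitz _ => 0

def IsSmooth (γ : ℝ) (φ : ℝ → ℝ) : Prop :=
  Differentiable ℝ φ ∧ ∀ a b, |deriv φ a - deriv φ b| ≤ 1 / γ * |a - b|

def IsLip (L : ℝ) (φ : ℝ → ℝ) : Prop := ∀ a b, |φ a - φ b| ≤ L * |a - b|

/-- The data of `min_w (1/n) ∑ᵢ φᵢ(xᵢᵀ w) + lam * g w`. -/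
structure Problem (n d : ℕ) where
  x : Fin n → Vec d
  φ : Fin n → ℝ → ℝ
  g : Vec d → ℝ
  lam : ℝ

namespace Problem

variable {n d : ℕ} (p : Problem n d)

/-- `v(α) = (1/(λ n)) ∑ᵢ αᵢ xᵢ`. -/
def v (α : Fin n → ℝ) : Vec d := (1 / (p.lam * n)) • ∑ i, α i • p.x i

/-- `w(α) = ∇g*(v(α))`. -/
def w (α : Fin n → ℝ) : Vec d := gradient (conjVec p.g) (p.v α)

/-- The dual objective `D(α)`; it is `⊥` when some `φᵢ*(-αᵢ)` is infinite. -/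
def dual (α : Fin n → ℝ) : EReal :=
  ((1 / n : ℝ) : EReal) * ∑ i, -conj (p.φ i) (-α i)
    - ((p.lam * conjVec p.g (p.v α) : ℝ) : EReal)

/-- The proximal objective
`-φᵢ*(-(αᵢ + δ)) - w(α)ᵀ xᵢ δ - (1/(2 λ n)) ‖δ xᵢ‖_{D'}²` as a function of `δ`,
where `N` is the norm `‖·‖_{D'}`. -/
def proxObj (N : Vec d → ℝ) (α : Fin n → ℝ) (i : Fin n) (δ : ℝ) : EReal :=
  -conj (p.φ i) (-(α i + δ))
    - ((inner ℝ (p.w α) (p.x i) * δ + 1 / (2 * p.lam * n) * N (δ • p.x i) ^ 2 : ℝ) : EReal)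

/-- `-u ∈ ∂φᵢ(xᵢᵀ w(α))`. -/
def IsDualDirection (α : Fin n → ℝ) (i : Fin n) (u : ℝ) : Prop :=
  IsSubgradient (p.φ i) (inner ℝ (p.x i) (p.w α)) (-u)

/-- The closed-form step size
`s = (φᵢ(xᵢᵀw) + φᵢ*(-αᵢ) + wᵀxᵢ αᵢ + (γ/2) ζ) / (ζ (γ + ρ/(λ n)))`, truncated to `s ≤ 1`,
where `w = w(α)`, `ζ` stands for `z²` and `ρ` for the squared norm of the example.
A zero denominator gives `s = 1`. -/
def stepSize (γ ρ ζ : ℝ) (α : Fin n → ℝ) (i : Fin n) : ℝ :=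
  if ζ * (γ + ρ / (p.lam * n)) = 0 then 1
  else min 1 ((p.φ i (inner ℝ (p.x i) (p.w α)) + (conj (p.φ i) (-α i)).toReal
    + inner ℝ (p.w α) (p.x i) * α i + γ / 2 * ζ) / (ζ * (γ + ρ / (p.lam * n))))

/-- `p.OptionStep N R c α i δ`: the increment `δ` of the `i`-th dual variable at `α` is produced by
one of the five options of Prox-SDCA run with `‖·‖_{D'} = N`, `‖·‖_D = |·|` and bound `R` on
`maxᵢ ‖xᵢ‖_{D'}`, for losses of class `c`. -/
inductive OptionStep (N : Vec d → ℝ) (R : ℝ) (c : LossClass) (α : Fin n → ℝ) (i : Fin n) :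
    ℝ → Prop
  | optionI (δ : ℝ) (h : IsMaxOn (p.proxObj N α i) Set.univ δ) : OptionStep N R c α i δ
  | optionII (u s : ℝ) (hu : p.IsDualDirection α i u) (hs : s ∈ Set.Icc (0 : ℝ) 1)
      (h : IsMaxOn (fun s' : ℝ => p.proxObj N α i (s' * (u - α i))) (Set.Icc (0 : ℝ) 1) s) :
      OptionStep N R c α i (s * (u - α i))
  | optionIII (u : ℝ) (hu : p.IsDualDirection α i u) :
      OptionStep N R c α i
        (p.stepSize c.gamma (N (p.x i) ^ 2) ((u - α i) ^ 2) α i * (u - α i))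
  | optionIV (u : ℝ) (hu : p.IsDualDirection α i u) :
      OptionStep N R c α i (p.stepSize c.gamma (R ^ 2) ((u - α i) ^ 2) α i * (u - α i))
  | optionIVLip (L u ζ : ℝ) (hc : c = .lipschitz L) (hu : p.IsDualDirection α i u)
      (h₁ : (u - α i) ^ 2 ≤ ζ) (h₂ : ζ ≤ 4 * L ^ 2) :
      OptionStep N R c α i (p.stepSize c.gamma (R ^ 2) ζ α i * (u - α i))
  | optionV (γ : ℝ) (hc : c = .smooth γ) :
      OptionStep N R c α i
        (p.lam * n * γ / (R ^ 2 + p.lam * n * γ)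
          * (-deriv (p.φ i) (inner ℝ (p.x i) (p.w α)) - α i))

/-- One iteration with picked index `i`: only the `i`-th dual variable changes, by one of the
options or by any increment whose dual objective is at least that of one of the options. -/
def Step (N : Vec d → ℝ) (R : ℝ) (c : LossClass) (α : Fin n → ℝ) (i : Fin n)
    (α' : Fin n → ℝ) : Prop :=
  ∃ δ δ' : ℝ, α' = Function.update α i (α i + δ) ∧ p.OptionStep N R c α i δ' ∧
    p.dual (Function.update α i (α i + δ')) ≤ p.dual α'

/-- A run of Prox-SDCA: `a h` is the dual vector after the indices listed in `h` (oldest first)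
have been picked. The choices left open by the procedure may depend on the whole history. -/
structure IsRun (N : Vec d → ℝ) (R : ℝ) (c : LossClass) (a : List (Fin n) → Fin n → ℝ) :
    Prop where
  init : a [] = 0
  step : ∀ (h : List (Fin n)) (i : Fin n), p.Step N R c (a h) i (a (h ++ [i]))

/-- The primal iterate `w⁽ᵗ⁾` along the picked indices `ω`, for `t ≤ T`. -/
def iterate (a : List (Fin n) → Fin n → ℝ) {T : ℕ} (ω : Fin T → Fin n) (t : ℕ) : Vec d :=
  p.w (a ((List.ofFn ω).take t))

/-- Averaging output `(1/(T - T₀)) ∑_{t = T₀+1}^{T} w⁽ᵗ⁻¹⁾`. -/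
def avgOutput (a : List (Fin n) → Fin n → ℝ) (T₀ : ℕ) {T : ℕ} (ω : Fin T → Fin n) : Vec d :=
  (1 / ((T : ℝ) - T₀)) • ∑ t ∈ Finset.Ico T₀ T, p.iterate a ω t

/-- Expectation of `F (w⁽ᵀ⁾)`, the `T` indices being drawn independently and uniformly. -/
def expLast (F : Vec d → ℝ) (a : List (Fin n) → Fin n → ℝ) (T : ℕ) : ℝ :=
  𝔼 ω : Fin T → Fin n, F (p.iterate a ω T)

/-- Expectation of `F` at the averaging output. -/
def expAvg (F : Vec d → ℝ) (a : List (Fin n) → Fin n → ℝ) (T₀ T : ℕ) : ℝ :=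
  𝔼 ω : Fin T → Fin n, F (p.avgOutput a T₀ ω)

/-- Expectation of `F` at the random output `w⁽ᵗ⁾`, `t` uniform in `{T₀+1, …, T}`. -/
def expRandom (F : Vec d → ℝ) (a : List (Fin n) → Fin n → ℝ) (T₀ T : ℕ) : ℝ :=
  𝔼 ω : Fin T → Fin n, 𝔼 t ∈ Finset.Ioc T₀ T, F (p.iterate a ω t)

end Problem

/-- The `ℓ¹`-regularized objective `(1/n) ∑ᵢ φᵢ(xᵢᵀ w) + σ ‖w‖₁`. -/
def l1Objective {n d : ℕ} (x : Fin n → Vec d) (φ : Fin n → ℝ → ℝ) (σ : ℝ) (w : Vec d) : ℝ :=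
  1 / n * ∑ i, φ i (inner ℝ (x i) w) + σ * l1 w

/-- `λ = ε / (3 log(d) B²)`. -/
def lamChoice (d : ℕ) (ε B : ℝ) : ℝ := ε / (3 * Real.log d * B ^ 2)

/-- `g(w) = (3 log(d) / 2) ‖w‖_q² + (σ/λ) ‖w‖₁` with `q = log(d) / (log(d) - 1)`. -/
def gChoice (d : ℕ) (σ lam : ℝ) (w : Vec d) : ℝ :=
  3 * Real.log d / 2 * lq (Real.log d / (Real.log d - 1)) w ^ 2 + σ / lam * l1 w

/-- The problem to which Prox-SDCA is applied. -/
def qProblem {n d : ℕ} (x : Fin n → Vec d) (φ : Fin n → ℝ → ℝ) (σ ε B : ℝ) : Problem n d where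
  x := x
  φ := φ
  g := gChoice d σ (lamChoice d ε B)
  lam := lamChoice d ε B

/-- The absolute constant `e / √3`: the function `g` above is `1`-strongly convex with respect to
`(√3 / e) ‖·‖₁`, whose dual norm is `(e / √3) ‖·‖_∞`. -/
def kappa : ℝ := Real.exp 1 / Real.sqrt 3

/-- The norm `‖·‖_{D'} = (e / √3) ‖·‖_∞`. -/
def normD' {d : ℕ} (w : Vec d) : ℝ := kappa * linf w

/-- Runs of Prox-SDCA for the `ℓ¹` problem, with `R` a bound on `maxᵢ ‖xᵢ‖_∞`. -/
def IsQRun {n d : ℕ} (x : Fin n → Vec d) (φ : Fin n → ℝ → ℝ) (σ ε B R : ℝ) (c : LossClass)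
    (a : List (Fin n) → Fin n → ℝ) : Prop :=
  (qProblem x φ σ ε B).IsRun normD' (kappa * R) c a

/-- `C M (1 + log(1 + M/ε))`: the quantity `M` up to a constant and a logarithmic factor. -/
def tildeO (C M ε : ℝ) : ℝ := C * M * (1 + Real.log (1 + M / ε))

end ProxSDCA

end

namespace ProxSDCA

/-! ### Strong convexity of the squared `ℓ^q` norm -/

/-! The run is controlled through the duality gap of a slightly modified problem. Adding
(ε/2B²)‖w‖_q² to F costs at most ε/2 at w*, because ‖w*‖_q ≤ ‖w*‖₁ ≤ B, and it makes the regularizer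
g 1-strongly convex for ‖·‖₁/κ. Indeed squared ℓ^q norms are 2-uniformly convex (`lq_sq_add_le`),
and the exponent conjugate to q is log d, so that ‖·‖₁ ≤ e‖·‖_q without a dimension factor
(`gChoice_strongReg`). Hence g* is 1-smooth for κ‖·‖_∞ (`StrongReg.conj_spec`).

By this smoothness the proximal objective bounds the dual increase from below
(`Regular.dualReal_update`). Moving α_i a fraction s towards a negative subgradient gains s times
the i-th part of the gap, up to a quadratic error in s. For smooth losses, strong convexity of φ_i*
cancels the error at one particular s. Every option does at least as well (`Regular.option_bound`).

Averaging over i gives A(t+1) ≤ A(t) − G(t)/τ + k for the expected dual suboptimality A and gap G,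
with A ≤ G and A(0) ≤ 1 (`Regular.exists_recursion`). In the smooth case k = 0, so A decays
geometrically and G ≤ τA. In the Lipschitz case A decays to the noise level kτ, after which
telescoping over a window of length at least τ bounds the mean gap. Either way the gap costs at most
the remaining ε/2. -/

lemma one_add_mul_sq_le_rpow_add_rpow {q t : ℝ} (hq : 1 < q) (hq2 : q ≤ 2) (ht : t ∈ Set.Icc (0 : ℝ) 1) :
    2 + q * (q - 1) * t ^ 2 ≤ (1 + t) ^ q + (1 - t) ^ q := by
  -- Up to the factor q, `h'` is the derivative of right side minus quadratic. Its own derivative is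
  -- nonnegative by AM-GM: the product (1 - s²)^(q-2) is at least 1 because q ≤ 2.
  let h' : ℝ → ℝ := fun t => (1 + t) ^ (q - 1) - (1 - t) ^ (q - 1) - 2 * (q - 1) * t
  have hd' : ∀ s ∈ Set.Ioo (0 : ℝ) 1, HasDerivAt h'
      ((q - 1) * ((1 + s) ^ (q - 2) + (1 - s) ^ (q - 2) - 2)) s := by
    intro s hs
    have e1 : HasDerivAt (fun t : ℝ => 1 + t) 1 s := (hasDerivAt_id s).const_add 1
    have e2 : HasDerivAt (fun t : ℝ => 1 - t) (-1) s := (hasDerivAt_id s).const_sub 1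
    have h1 := e1.rpow_const (p := q - 1) (Or.inl (by linarith [hs.1]))
    have h2 := e2.rpow_const (p := q - 1) (Or.inl (by linarith [hs.2]))
    have h3 := (hasDerivAt_id s).const_mul (2 * (q - 1))
    refine ((h1.sub h2).sub h3).congr_deriv ?_
    rw [show q - 1 - 1 = q - 2 by ring]
    ring
  have hmono' : MonotoneOn h' (Set.Icc 0 1) := by
    apply monotoneOn_of_deriv_nonneg (convex_Icc 0 1)
    · apply ContinuousOn.sub
      · apply ContinuousOn.sub
        · exact ContinuousOn.rpow_const (by fun_prop) (fun _ _ => Or.inr (by linarith))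
        · exact ContinuousOn.rpow_const (by fun_prop) (fun _ _ => Or.inr (by linarith))
      · fun_prop
    · rw [interior_Icc]
      exact fun s hs => (hd' s hs).differentiableAt.differentiableWithinAt
    · rw [interior_Icc]
      intro s hs
      rw [(hd' s hs).deriv]
      apply mul_nonneg (by linarith)
      have p1 : 0 < 1 + s := by linarith [hs.1]
      have p2 : 0 < 1 - s := by linarith [hs.2]
      have a1 : 0 < (1 + s) ^ (q - 2) := Real.rpow_pos_of_pos p1 _
      have a2 : 0 < (1 - s) ^ (q - 2) := Real.rpow_pos_of_pos p2 _
      have a3 : 1 ≤ (1 + s) ^ (q - 2) * (1 - s) ^ (q - 2) := by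
        rw [← Real.mul_rpow p1.le p2.le]
        exact Real.one_le_rpow_of_pos_of_le_one_of_nonpos (mul_pos p1 p2) (by nlinarith [hs.1]) (by linarith)
      nlinarith [sq_nonneg ((1 + s) ^ (q - 2) - (1 - s) ^ (q - 2))]
  have hpos' : ∀ s ∈ Set.Icc (0 : ℝ) 1, 0 ≤ h' s := by
    intro s hs
    have := hmono' (Set.left_mem_Icc.2 zero_le_one) hs hs.1
    simpa [h'] using this
  let h : ℝ → ℝ := fun t => (1 + t) ^ q + (1 - t) ^ q - q * (q - 1) * t ^ 2
  have hd : ∀ s ∈ Set.Ioo (0 : ℝ) 1, HasDerivAt h (q * h' s) s := by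
    intro s hs
    have e1 : HasDerivAt (fun t : ℝ => 1 + t) 1 s := (hasDerivAt_id s).const_add 1
    have e2 : HasDerivAt (fun t : ℝ => 1 - t) (-1) s := (hasDerivAt_id s).const_sub 1
    have h1 := e1.rpow_const (p := q) (Or.inl (by linarith [hs.1]))
    have h2 := e2.rpow_const (p := q) (Or.inl (by linarith [hs.2]))
    have h3 := (hasDerivAt_pow 2 s).const_mul (q * (q - 1))
    refine ((h1.add h2).sub h3).congr_deriv ?_
    simp only [h']
    push_cast
    ring
  have hmono : MonotoneOn h (Set.Icc 0 1) := by
    apply monotoneOn_of_deriv_nonneg (convex_Icc 0 1)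
    · apply ContinuousOn.sub
      · apply ContinuousOn.add
        · exact ContinuousOn.rpow_const (by fun_prop) (fun _ _ => Or.inr (by linarith))
        · exact ContinuousOn.rpow_const (by fun_prop) (fun _ _ => Or.inr (by linarith))
      · fun_prop
    · rw [interior_Icc]
      exact fun s hs => (hd s hs).differentiableAt.differentiableWithinAt
    · rw [interior_Icc]
      intro s hs
      rw [(hd s hs).deriv]
      exact mul_nonneg (by linarith) (hpos' s (Set.Ioo_subset_Icc_self hs))
  have := hmono (Set.left_mem_Icc.2 zero_le_one) ht ht.1
  simp [h] at this
  linarith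

/-- By homogeneity a = 1. Bernoulli for the exponent q/2 ≤ 1 reduces the left side to the quadratic
of the previous lemma. -/
lemma two_point_of_le {q a b : ℝ} (hq : 1 < q) (hq2 : q ≤ 2) (ha : 0 < a) (hb : 0 ≤ b)
    (hba : b ≤ a) :
    (a ^ 2 + (q - 1) * b ^ 2) ^ (q / 2) ≤ ((a + b) ^ q + (a - b) ^ q) / 2 := by
  have ht : b / a ∈ Set.Icc (0 : ℝ) 1 := ⟨by positivity, (div_le_one ha).2 hba⟩
  set t := b / a with htdef
  have hb' : b = a * t := by rw [htdef]; field_simp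
  have h1 : a ^ 2 + (q - 1) * b ^ 2 = a ^ 2 * (1 + (q - 1) * t ^ 2) := by rw [hb']; ring
  have hn : 0 ≤ (q - 1) * t ^ 2 := mul_nonneg (by linarith) (sq_nonneg _)
  have h2 : (a ^ 2) ^ (q / 2) = a ^ q := by
    rw [← Real.rpow_natCast, ← Real.rpow_mul ha.le]; congr 1; push_cast; ring
  have h3 : (1 + (q - 1) * t ^ 2) ^ (q / 2) ≤ 1 + q / 2 * ((q - 1) * t ^ 2) :=
    rpow_one_add_le_one_add_mul_self (by linarith) (by linarith) (by linarith)
  have h4 := one_add_mul_sq_le_rpow_add_rpow hq hq2 ht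
  rw [h1, Real.mul_rpow (by positivity) (by linarith), h2, show a + b = a * (1 + t) by rw [hb']; ring,
    show a - b = a * (1 - t) by rw [hb']; ring, Real.mul_rpow ha.le (by linarith [ht.1]),
    Real.mul_rpow ha.le (by linarith [ht.2])]
  have h5 : 0 < a ^ q := Real.rpow_pos_of_pos ha _
  nlinarith

/-- The two-point inequality behind the `2`-uniform convexity of `ℓ^q`. -/
lemma two_point {q : ℝ} (hq : 1 < q) (hq2 : q ≤ 2) (a b : ℝ) :
    (a ^ 2 + (q - 1) * b ^ 2) ^ (q / 2) ≤ (|a + b| ^ q + |a - b| ^ q) / 2 := by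
  have key : ∀ a b : ℝ, 0 ≤ a → 0 ≤ b →
      (a ^ 2 + (q - 1) * b ^ 2) ^ (q / 2) ≤ (|a + b| ^ q + |a - b| ^ q) / 2 := by
    intro a b ha hb
    rcases le_total b a with h | h
    · rcases ha.eq_or_lt with rfl | ha
      · have : b = 0 := le_antisymm h hb
        subst this
        simp [Real.zero_rpow (by linarith : q ≠ 0), Real.zero_rpow (by linarith : q / 2 ≠ 0)]
      · rw [abs_of_nonneg (by linarith), abs_of_nonneg (by linarith)]
        exact two_point_of_le hq hq2 ha hb h
    · rcases hb.eq_or_lt with rfl | hb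
      · have : a = 0 := le_antisymm h ha
        subst this
        simp [Real.zero_rpow (by linarith : q ≠ 0), Real.zero_rpow (by linarith : q / 2 ≠ 0)]
      · rw [abs_of_nonneg (by linarith), abs_sub_comm, abs_of_nonneg (by linarith), add_comm a b]
        -- Swapping the roles is allowed: as q - 1 ≤ 1, giving the weight 1 to the larger number
        -- only increases the left side.
        refine le_trans (Real.rpow_le_rpow ?_ ?_ (by linarith)) (two_point_of_le hq hq2 hb ha h)
        · have : 0 ≤ q - 1 := by linarith
          positivity
        · nlinarith [mul_self_le_mul_self ha h]
  have := key |a| |b| (abs_nonneg _) (abs_nonneg _)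
  rw [sq_abs, sq_abs] at this
  refine this.trans_eq ?_
  rcases abs_cases a with ⟨h1, _⟩ | ⟨h1, _⟩ <;> rcases abs_cases b with ⟨h2, _⟩ | ⟨h2, _⟩ <;>
    rw [h1, h2]
  · rw [sub_neg_eq_add, ← sub_eq_add_neg, add_comm (|a - b| ^ q)]
  · rw [neg_add_eq_sub, abs_sub_comm b a, show -a - b = -(a + b) by ring, abs_neg,
      add_comm (|a - b| ^ q)]
  · rw [show -a + -b = -(a + b) by ring, show -a - -b = -(a - b) by ring, abs_neg, abs_neg]

/-- Minkowski for the ℓ^r norm on ℝ², applied to the vectors (A i, B i). -/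
lemma rpow_sum_add_rpow_sum_le {ι : Type*} (s : Finset ι) (A B : ι → ℝ) (hA : ∀ i, 0 ≤ A i)
    (hB : ∀ i, 0 ≤ B i) {r : ℝ} (hr : 1 ≤ r) :
    ((∑ i ∈ s, A i) ^ r + (∑ i ∈ s, B i) ^ r) ^ (1 / r) ≤ ∑ i ∈ s, (A i ^ r + B i ^ r) ^ (1 / r) := by
  classical
  induction s using Finset.induction_on with
  | empty => simp [Real.zero_rpow (by linarith : r ≠ 0), Real.zero_rpow (inv_ne_zero (by linarith : r ≠ 0))]
  | insert j s hj ih =>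
    rw [Finset.sum_insert hj, Finset.sum_insert hj, Finset.sum_insert hj]
    have := Real.Lp_add_le (Finset.univ : Finset (Fin 2)) ![A j, B j]
      ![∑ i ∈ s, A i, ∑ i ∈ s, B i] hr
    have sA : 0 ≤ ∑ i ∈ s, A i := Finset.sum_nonneg fun i _ => hA i
    have sB : 0 ≤ ∑ i ∈ s, B i := Finset.sum_nonneg fun i _ => hB i
    simp only [Fin.sum_univ_two, Matrix.cons_val_zero, Matrix.cons_val_one,
      abs_of_nonneg (add_nonneg (hA j) sA), abs_of_nonneg (add_nonneg (hB j) sB),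
      abs_of_nonneg (hA j), abs_of_nonneg (hB j), abs_of_nonneg sA, abs_of_nonneg sB] at this
    linarith

variable {d : ℕ}

lemma lq_nonneg (q : ℝ) (w : Vec d) : 0 ≤ lq q w :=
  Real.rpow_nonneg (Finset.sum_nonneg fun _ _ => Real.rpow_nonneg (abs_nonneg _) _) _

lemma sum_abs_rpow_nonneg (q : ℝ) (w : Vec d) : 0 ≤ ∑ j, |w j| ^ q :=
  Finset.sum_nonneg fun _ _ => Real.rpow_nonneg (abs_nonneg _) _

lemma lq_rpow {q : ℝ} (hq : 0 < q) (w : Vec d) : lq q w ^ q = ∑ j, |w j| ^ q := by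
  rw [lq, ← Real.rpow_mul (sum_abs_rpow_nonneg q w), one_div, inv_mul_cancel₀ hq.ne', Real.rpow_one]

lemma sum_rpow_two_div {q : ℝ} (hq : 0 < q) (w : Vec d) : (∑ j, |w j| ^ q) ^ (2 / q) = lq q w ^ 2 := by
  rw [← lq_rpow hq, ← Real.rpow_mul (lq_nonneg q w), mul_div_cancel₀ _ hq.ne']
  exact Real.rpow_natCast _ 2

/-- `2`-uniform convexity of the `ℓ^q` norm, `1 < q ≤ 2`. -/
lemma lq_sq_add_le {q : ℝ} (hq : 1 < q) (hq2 : q ≤ 2) (x y : Vec d) :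
    lq q x ^ 2 + (q - 1) * lq q y ^ 2 ≤ (lq q (x + y) ^ 2 + lq q (x - y) ^ 2) / 2 := by
  have q0 : 0 < q := by linarith
  have q1 : 0 ≤ q - 1 := by linarith
  have hr : 1 ≤ 2 / q := (one_le_div q0).2 hq2
  have hr0 : (1 : ℝ) / (2 / q) = q / 2 := by field_simp
  set c : ℝ := (q - 1) ^ (q / 2) with hc
  have c0 : 0 ≤ c := Real.rpow_nonneg q1 _
  have pw : ∀ t : ℝ, (|t| ^ q) ^ (2 / q) = t ^ 2 := by
    intro t
    rw [← Real.rpow_mul (abs_nonneg _), mul_div_cancel₀ _ q0.ne', ← sq_abs]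
    exact Real.rpow_natCast _ 2
  have cw : c ^ (2 / q) = q - 1 := by
    rw [hc, ← Real.rpow_mul q1, div_mul_div_cancel₀ (by norm_num), div_self q0.ne', Real.rpow_one]
  -- With r = 2/q the r-th powers of these entries are x_j² and (q - 1)y_j², so each summand on the
  -- right is a left side of `two_point`.
  have h1 := rpow_sum_add_rpow_sum_le Finset.univ (fun j => |x j| ^ q) (fun j => c * |y j| ^ q)
    (fun j => Real.rpow_nonneg (abs_nonneg _) _)
    (fun j => mul_nonneg c0 (Real.rpow_nonneg (abs_nonneg _) _)) hr
  have h2 : ∀ j, ((|x j| ^ q) ^ (2 / q) + (c * |y j| ^ q) ^ (2 / q)) ^ (1 / (2 / q))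
      ≤ (|x j + y j| ^ q + |x j - y j| ^ q) / 2 := by
    intro j
    rw [pw, Real.mul_rpow c0 (Real.rpow_nonneg (abs_nonneg _) _), pw, cw, hr0]
    exact two_point hq hq2 _ _
  have h3 := h1.trans (Finset.sum_le_sum fun j _ => h2 j)
  rw [← Finset.mul_sum, Real.mul_rpow c0 (sum_abs_rpow_nonneg q y), cw, sum_rpow_two_div q0,
    sum_rpow_two_div q0, hr0, ← Finset.sum_div, Finset.sum_add_distrib] at h3
  have e1 : ∑ j, |x j + y j| ^ q = lq q (x + y) ^ q := by rw [lq_rpow q0]; rfl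
  have e2 : ∑ j, |x j - y j| ^ q = lq q (x - y) ^ q := by rw [lq_rpow q0]; rfl
  rw [e1, e2] at h3
  have lhs0 : 0 ≤ lq q x ^ 2 + (q - 1) * lq q y ^ 2 := by positivity
  have h4 := Real.rpow_le_rpow (Real.rpow_nonneg lhs0 _) h3 (by linarith : (0 : ℝ) ≤ 2 / q)
  rw [← Real.rpow_mul lhs0, div_mul_div_cancel₀ (by norm_num), div_self q0.ne', Real.rpow_one] at h4
  refine h4.trans ?_
  have pa := Real.rpow_nonneg (lq_nonneg q (x + y)) q
  have pb := Real.rpow_nonneg (lq_nonneg q (x - y)) q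
  -- Convexity of t ↦ t^(2/q) turns the mean of q-th powers into the mean of squares.
  have h5 := Real.rpow_arith_mean_le_arith_mean_rpow (Finset.univ : Finset (Fin 2))
    (fun _ => 1 / 2) ![lq q (x + y) ^ q, lq q (x - y) ^ q] (by intros; norm_num)
    (by norm_num) (by intro i _; fin_cases i <;> simpa) hr
  have pw2 : ∀ t : ℝ, 0 ≤ t → (t ^ q) ^ (2 / q) = t ^ 2 := by
    intro t ht
    have := pw t
    rwa [abs_of_nonneg ht] at this
  simp only [Fin.sum_univ_two, Matrix.cons_val_zero, Matrix.cons_val_one, pw2 _ (lq_nonneg q _)] at h5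
  calc _ = (1 / 2 * lq q (x + y) ^ q + 1 / 2 * lq q (x - y) ^ q) ^ (2 / q) := by congr 1; ring
    _ ≤ _ := h5
    _ = _ := by ring

lemma lq_smul {q : ℝ} (hq : 0 < q) (c : ℝ) (w : Vec d) : lq q (c • w) = |c| * lq q w := by
  simp only [lq, PiLp.smul_apply, smul_eq_mul, abs_mul,
    Real.mul_rpow (abs_nonneg _) (abs_nonneg _), ← Finset.mul_sum]
  rw [Real.mul_rpow (Real.rpow_nonneg (abs_nonneg _) _) (sum_abs_rpow_nonneg q w),
    ← Real.rpow_mul (abs_nonneg _), mul_one_div, div_self hq.ne', Real.rpow_one]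

lemma l1_smul (c : ℝ) (w : Vec d) : l1 (c • w) = |c| * l1 w := by
  simp [l1, abs_mul, Finset.mul_sum]

lemma l1_add_le (x y : Vec d) : l1 (x + y) ≤ l1 x + l1 y := by
  simp only [l1, ← Finset.sum_add_distrib]
  exact Finset.sum_le_sum fun j _ => abs_add_le _ _

lemma l1_nonneg (w : Vec d) : 0 ≤ l1 w := Finset.sum_nonneg fun _ _ => abs_nonneg _

/-- Each |w j|^q is |w j| · |w j|^(q-1), and the second factor is at most ‖w‖₁^(q-1). -/
lemma lq_le_l1 {q : ℝ} (hq : 1 ≤ q) (w : Vec d) : lq q w ≤ l1 w := by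
  have q0 : 0 < q := by linarith
  have key : ∑ j, |w j| ^ q ≤ l1 w ^ q := by
    have split : ∀ t : ℝ, 0 ≤ t → t ^ q = t * t ^ (q - 1) := by
      intro t ht
      conv_lhs => rw [show q = 1 + (q - 1) by ring]
      rw [Real.rpow_add_of_nonneg ht zero_le_one (by linarith), Real.rpow_one]
    rw [split _ (l1_nonneg w)]
    conv_rhs => rw [l1, Finset.sum_mul]
    refine Finset.sum_le_sum fun j _ => ?_
    rw [split _ (abs_nonneg _)]
    have : |w j| ≤ l1 w :=
      Finset.single_le_sum (f := fun j => |w j|) (fun _ _ => abs_nonneg _) (Finset.mem_univ j)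
    exact mul_le_mul_of_nonneg_left (Real.rpow_le_rpow (abs_nonneg _) this (by linarith))
      (abs_nonneg _)
  refine (Real.rpow_le_rpow (sum_abs_rpow_nonneg q w) key (by positivity)).trans_eq ?_
  rw [← Real.rpow_mul (l1_nonneg w), mul_one_div, div_self q0.ne', Real.rpow_one]

lemma inner_le_l1_mul_linf (w v : Vec d) : inner ℝ w v ≤ l1 w * linf v := by
  rw [PiLp.inner_apply, l1, Finset.sum_mul]
  refine Finset.sum_le_sum fun j _ => ?_
  have : |v j| ≤ linf v := norm_le_pi_norm (WithLp.ofLp v) j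
  simp only [RCLike.inner_apply, conj_trivial]
  calc v j * w j ≤ |v j * w j| := le_abs_self _
    _ = |w j| * |v j| := by rw [abs_mul, mul_comm]
    _ ≤ _ := by gcongr

lemma norm_le_l1 (w : Vec d) : ‖w‖ ≤ l1 w := by
  rw [EuclideanSpace.norm_eq]
  apply Real.sqrt_le_iff.2 ⟨l1_nonneg w, ?_⟩
  simpa [l1] using Finset.sum_sq_le_sq_sum_of_nonneg (s := Finset.univ) (f := fun j => |w j|) (fun j _ => abs_nonneg _)

lemma linf_le_norm (w : Vec d) : linf w ≤ ‖w‖ :=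
  (pi_norm_le_iff_of_nonneg (norm_nonneg _)).2 fun j => PiLp.norm_apply_le w j

/-- Comparison of `ℓ¹` and `ℓ^q` for conjugate exponents `p, q`. -/
lemma l1_le_card_rpow_mul_lq {p q : ℝ} (h : p.HolderConjugate q) (w : Vec d) :
    l1 w ≤ (d : ℝ) ^ (1 / p) * lq q w := by
  have := Real.inner_le_Lp_mul_Lq Finset.univ (fun _ : Fin d => (1 : ℝ)) (fun j => |w j|) h
  simpa [l1, lq] using this

end ProxSDCA

namespace ProxSDCA

/-! ### Conjugates of strongly convex regularizers -/

lemma kappa_pos : 0 < kappa := by unfold kappa; positivity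

lemma kappa_sq : kappa ^ 2 = Real.exp 1 ^ 2 / 3 := by
  rw [kappa, div_pow, Real.sq_sqrt (by norm_num)]

lemma linf_nonneg {d : ℕ} (w : Vec d) : 0 ≤ linf w := norm_nonneg _

lemma linf_smul {d : ℕ} (c : ℝ) (w : Vec d) : linf (c • w) = |c| * linf w := by
  simp [linf, norm_smul]

lemma normD'_smul {d : ℕ} (c : ℝ) (w : Vec d) : normD' (c • w) = |c| * normD' w := by
  rw [normD', linf_smul, normD']; ring

/-- Continuous, coercive, nonnegative regularizers, normalized at `0`, that are midpoint
`1`-strongly convex with respect to the norm `κ⁻¹ ‖·‖₁` dual to `‖·‖_{D'}`. -/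
structure StrongReg {d : ℕ} (g : Vec d → ℝ) : Prop where
  cont : Continuous g
  zero : g 0 = 0
  coercive : ∃ k : ℝ, 0 < k ∧ ∀ w, k * ‖w‖ ^ 2 ≤ g w
  mid : ∀ a b, g ((1 / 2 : ℝ) • (a + b)) ≤ (g a + g b) / 2 - 1 / 8 * (l1 (a - b) / kappa) ^ 2

section

variable {d : ℕ} {g : Vec d → ℝ}

lemma StrongReg.nonneg (hg : StrongReg g) (w : Vec d) : 0 ≤ g w := by
  obtain ⟨k, hk, h⟩ := hg.coercive
  exact le_trans (by positivity) (h w)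

lemma StrongReg.bddAbove (hg : StrongReg g) (v : Vec d) :
    BddAbove (Set.range fun w : Vec d => inner ℝ w v - g w) := by
  obtain ⟨k, hk, h⟩ := hg.coercive
  refine ⟨‖v‖ ^ 2 / (4 * k), ?_⟩
  rintro _ ⟨w, rfl⟩
  have h1 := real_inner_le_norm w v
  have h2 := h w
  have h3 : ‖w‖ * ‖v‖ - k * ‖w‖ ^ 2 ≤ ‖v‖ ^ 2 / (4 * k) := by
    rw [le_div_iff₀ (by positivity)]
    nlinarith [sq_nonneg (2 * k * ‖w‖ - ‖v‖)]
  simp only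
  linarith

/-- The Fenchel–Young inequality. -/
lemma StrongReg.inner_sub_le (hg : StrongReg g) (w v : Vec d) :
    inner ℝ w v - g w ≤ conjVec g v :=
  le_ciSup (hg.bddAbove v) w

lemma StrongReg.exists_max (hg : StrongReg g) (v : Vec d) :
    ∃ w₀, ∀ w, inner ℝ w v - g w ≤ inner ℝ w₀ v - g w₀ := by
  obtain ⟨k, hk, h⟩ := hg.coercive
  have hc : Continuous fun w : Vec d => g w - inner ℝ w v := by
    have := hg.cont
    fun_prop
  have ht : Filter.Tendsto (fun w : Vec d => g w - inner ℝ w v) (Filter.cocompact _)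
      Filter.atTop := by
    have t1 : Filter.Tendsto (fun r : ℝ => r * (k * r - ‖v‖)) Filter.atTop Filter.atTop :=
      Filter.tendsto_id.atTop_mul_atTop₀
        (Filter.tendsto_atTop_add_const_right _ _ (Filter.tendsto_id.const_mul_atTop hk))
    refine Filter.tendsto_atTop_mono (fun w => ?_) (t1.comp (tendsto_norm_cocompact_atTop (E := Vec d)))
    have h1 := real_inner_le_norm w v
    have h2 := h w
    simp only [Function.comp]
    nlinarith
  obtain ⟨w₀, hw⟩ := hc.exists_forall_le ht
  exact ⟨w₀, fun w => by linarith [hw w]⟩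

/-- Quadratic growth of a strongly convex function away from its minimizer. -/
lemma StrongReg.growth (hg : StrongReg g) {v w₀ : Vec d}
    (h : ∀ w, inner ℝ w v - g w ≤ inner ℝ w₀ v - g w₀) (w : Vec d) :
    1 / 2 * (l1 (w - w₀) / kappa) ^ 2 ≤ (inner ℝ w₀ v - g w₀) - (inner ℝ w v - g w) := by
  -- Bisecting towards the maximizer: a constant c at the midpoint yields c/2 + 1/4 at `w`. Starting
  -- from 0, the constants increase to the fixed point 1/2.
  have key : ∀ (m : ℕ) (w : Vec d), (1 / 2 - 1 / 2 * (1 / 2) ^ m) * (l1 (w - w₀) / kappa) ^ 2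
      ≤ (inner ℝ w₀ v - g w₀) - (inner ℝ w v - g w) := by
    intro m
    induction m with
    | zero => intro w; simpa using h w
    | succ m ih =>
      intro w
      have h1 := ih ((1 / 2 : ℝ) • (w + w₀))
      have h2 := hg.mid w w₀
      have h3 : (1 / 2 : ℝ) • (w + w₀) - w₀ = (1 / 2 : ℝ) • (w - w₀) := by module
      rw [h3, l1_smul, abs_of_pos (by norm_num), inner_smul_left, inner_add_left] at h1
      simp only [conj_trivial] at h1
      have h4 : (1 / 2 * l1 (w - w₀) / kappa) ^ 2 = 1 / 4 * (l1 (w - w₀) / kappa) ^ 2 := by ring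
      rw [h4] at h1
      rw [pow_succ]
      nlinarith
  have lim : Filter.Tendsto (fun m : ℕ => (1 / 2 - 1 / 2 * (1 / 2 : ℝ) ^ m) * (l1 (w - w₀) / kappa) ^ 2)
      Filter.atTop (nhds ((1 / 2 - 1 / 2 * 0) * (l1 (w - w₀) / kappa) ^ 2)) :=
    ((tendsto_const_nhds).sub ((tendsto_pow_atTop_nhds_zero_of_lt_one (by norm_num) (by norm_num)).const_mul _)).mul_const _
  have := le_of_tendsto' lim fun m => key m w
  simpa using this

/-- The conjugate of a strongly convex regularizer is differentiable and smooth. -/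
lemma StrongReg.conj_spec (hg : StrongReg g) (v : Vec d) :
    conjVec g v = inner ℝ (gradient (conjVec g) v) v - g (gradient (conjVec g) v) ∧
    ∀ Δ, conjVec g (v + Δ) ≤ conjVec g v + inner ℝ (gradient (conjVec g) v) Δ
      + 1 / 2 * normD' Δ ^ 2 := by
  obtain ⟨w₀, hw₀⟩ := hg.exists_max v
  have e0 : conjVec g v = inner ℝ w₀ v - g w₀ :=
    le_antisymm (ciSup_le hw₀) (hg.inner_sub_le _ _)
  -- Hölder bounds the gain from Δ by (‖w - w₀‖₁/κ)·‖Δ‖_{D'}; AM-GM absorbs it into the quadratic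
  -- growth.
  have up : ∀ Δ, conjVec g (v + Δ) ≤ conjVec g v + inner ℝ w₀ Δ + 1 / 2 * normD' Δ ^ 2 := by
    intro Δ
    refine ciSup_le fun w => ?_
    have h1 := hg.growth hw₀ w
    have h2 := inner_le_l1_mul_linf (w - w₀) Δ
    rw [inner_sub_left] at h2
    have h3 : l1 (w - w₀) * linf Δ = (l1 (w - w₀) / kappa) * normD' Δ := by
      rw [normD']; field_simp [kappa_pos.ne']
    rw [inner_add_right]
    nlinarith [sq_nonneg (l1 (w - w₀) / kappa - normD' Δ)]
  -- The remainder is nonnegative by Fenchel–Young at `w₀` and quadratically small by `up`, so the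
  -- maximizer is the gradient.
  have hgrad : HasGradientAt (conjVec g) w₀ v := by
    rw [hasGradientAt_iff_isLittleO]
    have hO : (fun x' => conjVec g x' - conjVec g v - inner ℝ w₀ (x' - v)) =O[nhds v]
        fun x' => ‖x' - v‖ ^ 2 := by
      refine Asymptotics.IsBigO.of_bound (1 / 2 * kappa ^ 2) (Filter.Eventually.of_forall fun x' => ?_)
      have h1 := up (x' - v)
      rw [add_sub_cancel] at h1
      have h2 := hg.inner_sub_le w₀ x'
      have h3 : normD' (x' - v) ^ 2 ≤ kappa ^ 2 * ‖x' - v‖ ^ 2 := by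
        rw [normD', mul_pow]
        have := linf_le_norm (x' - v)
        have := linf_nonneg (x' - v)
        gcongr
      have h4 : inner ℝ w₀ (x' - v) = inner ℝ w₀ x' - inner ℝ w₀ v := inner_sub_right _ _ _
      rw [Real.norm_eq_abs, Real.norm_eq_abs, abs_of_nonneg (by linarith),
        abs_of_nonneg (by positivity)]
      linarith
    refine hO.trans_isLittleO ?_
    have : Filter.Tendsto (fun x' : Vec d => x' - v) (nhds v) (nhds 0) := by
      have : Continuous fun x' : Vec d => x' - v := by fun_prop
      simpa using this.tendsto v
    exact (Asymptotics.isLittleO_norm_pow_id one_lt_two).comp_tendsto this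
  rw [hgrad.gradient]
  exact ⟨e0, up⟩

end

/-! ### The regularizer of the `ℓ¹` problem -/

/-- This is where d ≥ 8 enters: log d ≥ 2 is exactly what q ≤ 2 needs. -/
lemma two_lt_log {d : ℕ} (hd : 8 ≤ d) : 2 < Real.log d := by
  have h1 : Real.log 8 ≤ Real.log d := Real.log_le_log (by norm_num) (by exact_mod_cast hd)
  have h2 : Real.log 8 = 3 * Real.log 2 := by
    rw [show (8 : ℝ) = 2 ^ 3 by norm_num, Real.log_pow]; norm_num
  linarith [Real.log_two_gt_d9]

/-- Hölder with exponent p = log d, for which d^(1/p) = e. -/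
lemma l1_le_exp_mul_lq {d : ℕ} (hd : 8 ≤ d) (w : Vec d) :
    l1 w ≤ Real.exp 1 * lq (Real.log d / (Real.log d - 1)) w := by
  have hl := two_lt_log hd
  have hc : (Real.log d).HolderConjugate (Real.log d / (Real.log d - 1)) :=
    Real.HolderConjugate.conjExponent (by linarith)
  have := l1_le_card_rpow_mul_lq hc w
  rwa [Real.rpow_def_of_pos (by positivity), mul_one_div, div_self (by linarith)] at this

/-- Uniform convexity contributes (3p/2)(q - 1)/4 = 3q/8 ≥ 3/8 times ‖a - b‖_q², where p(q - 1) = q.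
Since κ² = e²/3, this dominates ‖a - b‖₁²/(8κ²). The ℓ¹ term only needs the triangle inequality. -/
lemma gChoice_strongReg {d : ℕ} (hd : 8 ≤ d) {σ lam : ℝ} (hσ : 0 < σ) (hlam : 0 < lam) :
    StrongReg (gChoice d σ lam) := by
  have hl := two_lt_log hd
  set p := Real.log d with hp
  set q := p / (p - 1) with hq
  have p1 : 0 < p - 1 := by linarith
  have q1 : 1 < q := by rw [hq, one_lt_div p1]; linarith
  have q2 : q ≤ 2 := by rw [hq, div_le_iff₀ p1]; linarith
  have q0 : 0 < q := by linarith
  have hqp : p * (q - 1) = q := by rw [hq]; field_simp; ring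
  have e0 : 0 < Real.exp 1 := Real.exp_pos 1
  have hτ : 0 < σ / lam := div_pos hσ hlam
  have cl : Continuous fun w : Vec d => l1 w := by unfold l1; fun_prop
  have cq : Continuous fun w : Vec d => lq q w := by
    unfold lq
    refine Continuous.rpow_const ?_ fun _ => Or.inr (by positivity)
    exact continuous_finsetSum _ fun j _ =>
      Continuous.rpow_const (by fun_prop) fun _ => Or.inr (by positivity)
  refine ⟨?_, ?_, ⟨3 * p / 2 / Real.exp 1 ^ 2, by positivity, fun w => ?_⟩, fun a b => ?_⟩
  · unfold gChoice
    exact ((cq.pow 2).const_mul _).add (cl.const_mul _)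
  · have h1 : lq q (0 : Vec d) = 0 := by simpa using lq_smul q0 0 (0 : Vec d)
    have h2 : l1 (0 : Vec d) = 0 := by simp [l1]
    simp [gChoice, ← hp, ← hq, h1, h2]
  · have h1 := (norm_le_l1 w).trans (l1_le_exp_mul_lq hd w)
    have h2 : ‖w‖ ^ 2 ≤ Real.exp 1 ^ 2 * lq q w ^ 2 := by
      rw [← mul_pow]; exact pow_le_pow_left₀ (norm_nonneg _) h1 2
    have h3 : 3 * p / 2 / Real.exp 1 ^ 2 * ‖w‖ ^ 2 ≤ 3 * p / 2 * lq q w ^ 2 := by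
      rw [div_mul_eq_mul_div, div_le_iff₀ (by positivity)]
      nlinarith
    have h4 := mul_nonneg hτ.le (l1_nonneg w)
    simp only [gChoice]
    linarith
  · have h1 := lq_sq_add_le q1 q2 ((1 / 2 : ℝ) • (a + b)) ((1 / 2 : ℝ) • (a - b))
    have h2 : (1 / 2 : ℝ) • (a + b) + (1 / 2 : ℝ) • (a - b) = a := by module
    have h3 : (1 / 2 : ℝ) • (a + b) - (1 / 2 : ℝ) • (a - b) = b := by module
    rw [h2, h3, lq_smul q0 _ (a - b), abs_of_pos (by norm_num)] at h1
    have h4 : l1 ((1 / 2 : ℝ) • (a + b)) ≤ (l1 a + l1 b) / 2 := by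
      rw [l1_smul, abs_of_pos (by norm_num)]
      linarith [l1_add_le a b]
    have h5 : l1 (a - b) ^ 2 ≤ Real.exp 1 ^ 2 * lq q (a - b) ^ 2 := by
      rw [← mul_pow]; exact pow_le_pow_left₀ (l1_nonneg _) (l1_le_exp_mul_lq hd _) 2
    have h6 : (l1 (a - b) / kappa) ^ 2 ≤ 3 * lq q (a - b) ^ 2 := by
      rw [div_pow, kappa_sq, div_le_iff₀ (by positivity)]
      linarith
    have h7 := mul_le_mul_of_nonneg_left h4 hτ.le
    have h8 := mul_le_mul_of_nonneg_left h1 (by positivity : 0 ≤ 3 * p / 2)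
    have h9 : 3 * p / 2 * ((q - 1) * (1 / 2 * lq q (a - b)) ^ 2)
        = 3 / 8 * q * lq q (a - b) ^ 2 := by
      linear_combination 3 / 8 * lq q (a - b) ^ 2 * hqp
    have h10 : lq q (a - b) ^ 2 ≤ q * lq q (a - b) ^ 2 :=
      le_mul_of_one_le_left (sq_nonneg _) q1.le
    simp only [gChoice, ← hp, ← hq]
    rw [mul_add, h9] at h8
    linarith

end ProxSDCA

namespace ProxSDCA

/-! ### Scalar losses and their conjugates -/

lemma conj_le_iff (φ : ℝ → ℝ) (y A : ℝ) : conj φ y ≤ (A : EReal) ↔ ∀ z, z * y - φ z ≤ A := by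
  simp only [conj, iSup_le_iff, EReal.coe_le_coe_iff]

lemma conj_ne_bot (φ : ℝ → ℝ) (y : ℝ) : conj φ y ≠ ⊥ :=
  ne_bot_of_le_ne_bot (EReal.coe_ne_bot _) (le_iSup (fun z : ℝ => ((z * y - φ z : ℝ) : EReal)) 0)

lemma coe_toReal_conj {φ : ℝ → ℝ} {y : ℝ} (h : conj φ y ≠ ⊤) :
    ((conj φ y).toReal : EReal) = conj φ y := EReal.coe_toReal h (conj_ne_bot φ y)

lemma sub_le_toReal_conj {φ : ℝ → ℝ} {y : ℝ} (h : conj φ y ≠ ⊤) (z : ℝ) :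
    z * y - φ z ≤ (conj φ y).toReal :=
  (conj_le_iff φ y _).1 (coe_toReal_conj h).ge z

lemma toReal_conj_le {φ : ℝ → ℝ} {y A : ℝ} (h : conj φ y ≤ (A : EReal)) :
    (conj φ y).toReal ≤ A :=
  EReal.toReal_le_toReal h (conj_ne_bot φ y) (EReal.coe_ne_top A)

/-- The conjugate of `φ` is `γ`-strongly convex on its domain. -/
def ConjStrong (γ : ℝ) (φ : ℝ → ℝ) : Prop :=
  ∀ s ∈ Set.Icc (0 : ℝ) 1, ∀ y₀ y₁ A₀ A₁ : ℝ, conj φ y₀ ≤ (A₀ : EReal) → conj φ y₁ ≤ (A₁ : EReal) →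
    conj φ ((1 - s) * y₀ + s * y₁) ≤
      (((1 - s) * A₀ + s * A₁ - γ / 2 * (s * (1 - s)) * (y₀ - y₁) ^ 2 : ℝ) : EReal)

/-- A supremum of affine functions is convex; this suffices for Lipschitz losses, where γ = 0. -/
lemma conjStrong_zero (φ : ℝ → ℝ) : ConjStrong 0 φ := by
  intro s hs y₀ y₁ A₀ A₁ h₀ h₁
  rw [conj_le_iff] at *
  intro z
  have e0 := mul_le_mul_of_nonneg_left (h₀ z) (sub_nonneg.2 hs.2)
  have e1 := mul_le_mul_of_nonneg_left (h₁ z) hs.1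
  linarith

/-- Smoothness says that t²/(2γ) - φ has monotone derivative, hence is convex; duality turns this
into strong convexity of the conjugate. -/
lemma conjStrong_of_isSmooth {γ : ℝ} (hγ : 0 < γ) {φ : ℝ → ℝ} (h : IsSmooth γ φ) :
    ConjStrong γ φ := by
  have hconv : ConvexOn ℝ Set.univ fun t => t ^ 2 / (2 * γ) - φ t := by
    have hd : ∀ t, HasDerivAt (fun t => t ^ 2 / (2 * γ) - φ t) (t / γ - deriv φ t) t := by
      intro t
      refine (((hasDerivAt_pow 2 t).div_const (2 * γ)).sub (h.1 t).hasDerivAt).congr_deriv ?_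
      field_simp
      simp
      ring
    refine Monotone.convexOn_univ_of_deriv (fun t => (hd t).differentiableAt) ?_
    intro a b hab
    rw [(hd a).deriv, (hd b).deriv]
    have h1 := (abs_le.1 (h.2 b a)).2
    rw [abs_of_nonneg (by linarith)] at h1
    have : 1 / γ * (b - a) = b / γ - a / γ := by ring
    linarith
  intro s hs y₀ y₁ A₀ A₁ h₀ h₁
  rw [conj_le_iff] at *
  intro z
  -- The two test points have weighted mean z, and their weighted variance, divided by 2γ, is the
  -- strong convexity term.
  have e0 := mul_le_mul_of_nonneg_left (h₀ (z + s * (γ * (y₀ - y₁)))) (sub_nonneg.2 hs.2)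
  have e1 := mul_le_mul_of_nonneg_left (h₁ (z - (1 - s) * (γ * (y₀ - y₁)))) hs.1
  have e2 := hconv.2 (Set.mem_univ (z + s * (γ * (y₀ - y₁))))
    (Set.mem_univ (z - (1 - s) * (γ * (y₀ - y₁)))) (sub_nonneg.2 hs.2) hs.1 (by ring)
  simp only [smul_eq_mul] at e2
  rw [show (1 - s) * (z + s * (γ * (y₀ - y₁))) + s * (z - (1 - s) * (γ * (y₀ - y₁))) = z by ring] at e2
  have e3 : (1 - s) * ((z + s * (γ * (y₀ - y₁))) ^ 2 / (2 * γ))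
      + s * ((z - (1 - s) * (γ * (y₀ - y₁))) ^ 2 / (2 * γ)) - z ^ 2 / (2 * γ)
      = γ / 2 * (s * (1 - s)) * (y₀ - y₁) ^ 2 := by
    field_simp
    ring
  linarith

lemma exists_isSubgradient {φ : ℝ → ℝ} (h : ConvexOn ℝ Set.univ φ) (a : ℝ) :
    ∃ u, IsSubgradient φ a u := by
  have ia : ∀ a : ℝ, a ∈ interior (Set.univ : Set ℝ) := by simp
  refine ⟨derivWithin φ (Set.Ioi a) a, fun b => ?_⟩
  rcases lt_trichotomy a b with hab | rfl | hab
  · have := h.rightDeriv_le_slope_of_mem_interior (ia a) (Set.mem_univ b) hab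
    rw [slope_def_field, le_div_iff₀ (by linarith)] at this
    linarith
  · simp
  · have h1 := h.slope_le_leftDeriv_of_mem_interior (Set.mem_univ b) (ia a) hab
    have h2 := h.leftDeriv_le_rightDeriv_of_mem_interior (ia a)
    have h3 := h1.trans h2
    rw [slope_def_field, div_le_iff₀ (by linarith)] at h3
    linarith

lemma isSubgradient_deriv {φ : ℝ → ℝ} (h : ConvexOn ℝ Set.univ φ) (hd : Differentiable ℝ φ)
    (a : ℝ) : IsSubgradient φ a (deriv φ a) := by
  intro b
  rcases lt_trichotomy a b with hab | rfl | hab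
  · have := h.deriv_le_slope (Set.mem_univ a) (Set.mem_univ b) hab (hd a)
    rw [slope_def_field, le_div_iff₀ (by linarith)] at this
    linarith
  · simp
  · have := h.slope_le_deriv (Set.mem_univ b) (Set.mem_univ a) hab (hd a)
    rw [slope_def_field, div_le_iff₀ (by linarith)] at this
    linarith

lemma IsSubgradient.conj_le {φ : ℝ → ℝ} {a u : ℝ} (h : IsSubgradient φ a u) :
    conj φ u ≤ ((a * u - φ a : ℝ) : EReal) := by
  rw [conj_le_iff]
  intro z
  linarith [h z]

/-- Otherwise z·y - φ z would grow linearly along one of the two rays. This confines dual variables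
and directions to [-L, L]. -/
lemma IsLip.abs_le_of_conj_le {L : ℝ} {φ : ℝ → ℝ} (h : IsLip L φ) {y A : ℝ}
    (hy : conj φ y ≤ (A : EReal)) : |y| ≤ L := by
  rw [conj_le_iff] at hy
  by_contra! hlt
  have key : ∀ t : ℝ, 0 ≤ t → t * (|y| - L) ≤ A + φ 0 := by
    intro t ht
    rcases abs_cases y with ⟨e, _⟩ | ⟨e, _⟩
    · have h1 := hy t
      have h2 := (abs_le.1 (h t 0)).2
      rw [sub_zero, abs_of_nonneg ht] at h2
      rw [e]; linarith
    · have h1 := hy (-t)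
      have h2 := (abs_le.1 (h (-t) 0)).2
      rw [sub_zero, abs_neg, abs_of_nonneg ht] at h2
      rw [e]; linarith
  have hpos : 0 < |y| - L := by linarith
  have h1 := key ((|A + φ 0| + 1) / (|y| - L)) (by positivity)
  rw [div_mul_cancel₀ _ hpos.ne'] at h1
  linarith [le_abs_self (A + φ 0)]

end ProxSDCA

/-! ### Extended-real bookkeeping and the dual analysis of one update -/

noncomputable section

namespace ProxSDCA

/-- Converts lower bounds on the extended-valued proximal objective into upper bounds on a
conjugate, including its infinite values. -/
lemma coe_le_neg_sub_iff (c : EReal) (e r : ℝ) :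
    (e : EReal) ≤ -c - (r : EReal) ↔ c ≤ ((-e - r : ℝ) : EReal) := by
  induction c with
  | bot => simp
  | top =>
    rw [EReal.neg_top, EReal.bot_sub, le_bot_iff, top_le_iff]
    simp only [EReal.coe_ne_bot, EReal.coe_ne_top]
  | coe c =>
    rw [← EReal.coe_neg, ← EReal.coe_sub, EReal.coe_le_coe_iff, EReal.coe_le_coe_iff]
    constructor <;> intro h <;> linarith

lemma coe_sum_ereal {ι : Type*} (s : Finset ι) (f : ι → ℝ) :
    ((∑ i ∈ s, f i : ℝ) : EReal) = ∑ i ∈ s, (f i : EReal) := by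
  classical
  induction s using Finset.induction_on with
  | empty => simp
  | insert j s hj ih => rw [Finset.sum_insert hj, Finset.sum_insert hj, EReal.coe_add, ih]

namespace Problem

variable {n d : ℕ} (p : Problem n d)

/-! ### Primal objective, dual objective and the duality gap -/

/-- The primal objective. -/
def primal (w : Vec d) : ℝ := 1 / n * ∑ i, p.φ i (inner ℝ (p.x i) w) + p.lam * p.g w

/-- The dual vectors at which the dual objective is finite. -/
def Feasible (α : Fin n → ℝ) : Prop := ∀ i, conj (p.φ i) (-α i) ≠ ⊤

/-- The dual objective as a real number. -/
def dualReal (α : Fin n → ℝ) : ℝ :=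
  1 / n * ∑ i, -(conj (p.φ i) (-α i)).toReal - p.lam * conjVec p.g (p.v α)

/-- The contribution of the `i`-th example to the duality gap at `w(α)`. -/
def gap (α : Fin n → ℝ) (i : Fin n) : ℝ :=
  p.φ i (inner ℝ (p.x i) (p.w α)) + (conj (p.φ i) (-α i)).toReal + inner ℝ (p.w α) (p.x i) * α i

/-- The lower bound for the increase of the proximal objective along a dual direction. -/
def ascent (γ ρ ζ Γ s : ℝ) : ℝ := s * Γ + ζ / 2 * (γ * (s * (1 - s)) - s ^ 2 * ρ / (p.lam * n))

/-- The standing assumptions on the problem. -/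
structure Regular : Prop where
  n_pos : 0 < n
  lam_pos : 0 < p.lam
  reg : StrongReg p.g

variable {p}

lemma dual_eq_dualReal {α : Fin n → ℝ} (h : p.Feasible α) : p.dual α = (p.dualReal α : EReal) := by
  rw [dual, dualReal, EReal.coe_sub, EReal.coe_mul (1 / (n : ℝ)), coe_sum_ereal]
  congr 2
  refine Finset.sum_congr rfl fun i _ => ?_
  rw [EReal.coe_neg, coe_toReal_conj (h i)]

/-- A single infinite conjugate makes the dual objective ⊥. Thus any increment that keeps the dual
above a real number preserves feasibility. -/
lemma Regular.feasible_of_le_dual (hp : p.Regular) {α : Fin n → ℝ} {r : ℝ}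
    (h : (r : EReal) ≤ p.dual α) : p.Feasible α := by
  classical
  intro i hi
  have hn : (0 : ℝ) < 1 / n := by have := hp.n_pos; positivity
  have : p.dual α = ⊥ := by
    rw [dual, ← Finset.add_sum_erase _ _ (Finset.mem_univ i), hi, EReal.neg_top, EReal.bot_add,
      EReal.coe_mul_bot_of_pos hn, EReal.bot_sub]
  rw [this] at h
  simp at h

lemma gap_nonneg {α : Fin n → ℝ} (h : p.Feasible α) (i : Fin n) : 0 ≤ p.gap α i := by
  have := sub_le_toReal_conj (h i) (inner ℝ (p.x i) (p.w α))
  rw [gap, real_inner_comm (p.w α)] at *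
  rw [real_inner_comm] at *
  linarith

lemma Regular.mul_inner_v (hp : p.Regular) (α : Fin n → ℝ) (w : Vec d) :
    p.lam * inner ℝ w (p.v α) = 1 / n * ∑ i, inner ℝ (p.x i) w * α i := by
  have hn : (n : ℝ) ≠ 0 := by exact_mod_cast hp.n_pos.ne'
  have hl := hp.lam_pos.ne'
  rw [v, inner_smul_right, inner_sum, ← mul_assoc]
  congr 1
  · field_simp
  · refine Finset.sum_congr rfl fun i _ => ?_
    rw [inner_smul_right, real_inner_comm, mul_comm]

/-- Weak duality: Fenchel–Young for g and for each loss. -/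
lemma Regular.dualReal_le_primal (hp : p.Regular) {α : Fin n → ℝ} (h : p.Feasible α) (w : Vec d) :
    p.dualReal α ≤ p.primal w := by
  have h1 := mul_le_mul_of_nonneg_left (hp.reg.inner_sub_le w (p.v α)) hp.lam_pos.le
  rw [mul_sub, hp.mul_inner_v] at h1
  have h2 : ∑ i, -(conj (p.φ i) (-α i)).toReal
      ≤ ∑ i, (p.φ i (inner ℝ (p.x i) w) + inner ℝ (p.x i) w * α i) :=
    Finset.sum_le_sum fun i _ => by
      linarith [sub_le_toReal_conj (h i) (inner ℝ (p.x i) w)]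
  have h3 := mul_le_mul_of_nonneg_left h2 (by positivity : (0 : ℝ) ≤ 1 / n)
  rw [Finset.sum_add_distrib, mul_add] at h3
  rw [dualReal, primal]
  linarith

/-- Fenchel–Young for g is an equality at w(α) = ∇g*(v(α)), so the regularizer terms become an inner
product that splits over the examples. -/
lemma Regular.primal_sub_dualReal (hp : p.Regular) (α : Fin n → ℝ) :
    p.primal (p.w α) - p.dualReal α = 1 / n * ∑ i, p.gap α i := by
  have h1 := (hp.reg.conj_spec (p.v α)).1
  have h2 := hp.mul_inner_v α (p.w α)
  have h3 : ∑ i, p.gap α i = ∑ i, p.φ i (inner ℝ (p.x i) (p.w α))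
      + ∑ i, (conj (p.φ i) (-α i)).toReal + ∑ i, inner ℝ (p.x i) (p.w α) * α i := by
    rw [← Finset.sum_add_distrib, ← Finset.sum_add_distrib]
    exact Finset.sum_congr rfl fun i _ => by rw [gap, real_inner_comm (p.x i)]
  change _ = inner ℝ (p.w α) (p.v α) - p.g (p.w α) at h1
  rw [h3, primal, dualReal, h1, Finset.sum_neg_distrib, mul_sub, h2]
  ring

/-! ### One iteration -/

/-- Smoothness of g* bounds its change by the linear and quadratic terms of the proximal objective.
-/
lemma Regular.dualReal_update (hp : p.Regular) {α : Fin n → ℝ} (h : p.Feasible α) (i : Fin n)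
    {δ e : ℝ}
    (he : ((e - (conj (p.φ i) (-α i)).toReal : ℝ) : EReal) ≤ p.proxObj normD' α i δ) :
    p.Feasible (Function.update α i (α i + δ)) ∧
      p.dualReal α + e / n ≤ p.dualReal (Function.update α i (α i + δ)) := by
  have hn : (0 : ℝ) < n := by exact_mod_cast hp.n_pos
  have hl := hp.lam_pos
  rw [proxObj, coe_le_neg_sub_iff] at he
  set α' := Function.update α i (α i + δ) with hα'
  have feas : p.Feasible α' := by
    intro j
    rcases eq_or_ne j i with rfl | hj
    · rw [hα', Function.update_self]
      exact ne_top_of_le_ne_top (EReal.coe_ne_top _) he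
    · rw [hα', Function.update_of_ne hj]
      exact h j
  refine ⟨feas, ?_⟩
  have hv : p.v α' = p.v α + (1 / (p.lam * n)) • (δ • p.x i) := by
    rw [v, v, ← smul_add]
    congr 1
    rw [← Finset.add_sum_erase _ _ (Finset.mem_univ i),
      ← Finset.add_sum_erase Finset.univ (fun i => α i • p.x i) (Finset.mem_univ i), hα',
      Function.update_self, add_smul]
    have : ∑ j ∈ Finset.univ.erase i, Function.update α i (α i + δ) j • p.x j
        = ∑ j ∈ Finset.univ.erase i, α j • p.x j :=
      Finset.sum_congr rfl fun j hj => by rw [Function.update_of_ne (Finset.ne_of_mem_erase hj)]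
    rw [this]
    abel
  have hsum : ∑ j, -(conj (p.φ j) (-α' j)).toReal = ∑ j, -(conj (p.φ j) (-α j)).toReal
      + (conj (p.φ i) (-α i)).toReal - (conj (p.φ i) (-(α i + δ))).toReal := by
    rw [← Finset.add_sum_erase _ _ (Finset.mem_univ i),
      ← Finset.add_sum_erase Finset.univ (fun j => -(conj (p.φ j) (-α j)).toReal)
        (Finset.mem_univ i), hα', Function.update_self]
    have : ∑ j ∈ Finset.univ.erase i, -(conj (p.φ j) (-Function.update α i (α i + δ) j)).toReal
        = ∑ j ∈ Finset.univ.erase i, -(conj (p.φ j) (-α j)).toReal :=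
      Finset.sum_congr rfl fun j hj => by rw [Function.update_of_ne (Finset.ne_of_mem_erase hj)]
    rw [this]
    ring
  have h1 := (hp.reg.conj_spec (p.v α)).2 ((1 / (p.lam * n)) • (δ • p.x i))
  have h2 := toReal_conj_le he
  change _ ≤ _ + inner ℝ (p.w α) _ + _ at h1
  rw [← hv, normD'_smul, inner_smul_right, inner_smul_right, abs_of_pos (by positivity)] at h1
  have h3 := mul_le_mul_of_nonneg_left h1 hl.le
  rw [dualReal, dualReal, hsum]
  have h4 : p.lam * (conjVec p.g (p.v α) + 1 / (p.lam * n) * (δ * inner ℝ (p.w α) (p.x i))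
        + 1 / 2 * (1 / (p.lam * n) * normD' (δ • p.x i)) ^ 2)
      = p.lam * conjVec p.g (p.v α) + 1 / n * (inner ℝ (p.w α) (p.x i) * δ
        + 1 / (2 * p.lam * n) * normD' (δ • p.x i) ^ 2) := by
    field_simp
    ring
  have h5 := mul_le_mul_of_nonneg_left h2 (by positivity : (0 : ℝ) ≤ 1 / n)
  rw [h4] at h3
  have h6 : e / n = 1 / n * e := by ring
  rw [h6]
  linarith

/-- Increase of the proximal objective along a dual direction. -/
lemma Regular.le_proxObj (hp : p.Regular) {α : Fin n → ℝ} (h : p.Feasible α) {i : Fin n} {γ u s : ℝ}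
    (hφ : ConjStrong γ (p.φ i)) (hu : p.IsDualDirection α i u) (hs : s ∈ Set.Icc (0 : ℝ) 1) :
    ((p.ascent γ (normD' (p.x i) ^ 2) ((u - α i) ^ 2) (p.gap α i) s
        - (conj (p.φ i) (-α i)).toReal : ℝ) : EReal)
      ≤ p.proxObj normD' α i (s * (u - α i)) := by
  have hn : (0 : ℝ) < n := by exact_mod_cast hp.n_pos
  have hl := hp.lam_pos
  rw [proxObj, coe_le_neg_sub_iff]
  -- The new argument of φ_i* is a convex combination of -α_i and the subgradient -u, where
  -- `hu.conj_le` bounds the conjugate.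
  have h1 := hφ s hs (-α i) (-u) _ _ (coe_toReal_conj (h i)).ge hu.conj_le
  rw [show (1 - s) * -α i + s * -u = -(α i + s * (u - α i)) by ring] at h1
  refine h1.trans (EReal.coe_le_coe_iff.2 (le_of_eq ?_))
  rw [normD'_smul, ascent, gap, mul_pow, sq_abs, real_inner_comm (p.w α)]
  field_simp
  ring

/-- The ascent bound is s·a - s²b/2 with a, b ≥ 0, maximized over [0,1] at min(1, a/b), or at 1 when
b = 0. -/
lemma ascent_le_ascent_stepSize (hp : p.Regular) {γ ρ ζ : ℝ} (hγ : 0 ≤ γ) (hρ : 0 ≤ ρ) (hζ : 0 ≤ ζ)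
    {α : Fin n → ℝ} (h : p.Feasible α) (i : Fin n) :
    p.stepSize γ ρ ζ α i ∈ Set.Icc (0 : ℝ) 1 ∧ ∀ s ∈ Set.Icc (0 : ℝ) 1,
      p.ascent γ ρ ζ (p.gap α i) s ≤ p.ascent γ ρ ζ (p.gap α i) (p.stepSize γ ρ ζ α i) := by
  have hn : (0 : ℝ) < n := by exact_mod_cast hp.n_pos
  have hl := hp.lam_pos
  have hΓ := gap_nonneg h i
  have hA : ∀ s, p.ascent γ ρ ζ (p.gap α i) s = s * (p.gap α i + γ / 2 * ζ)
      - s ^ 2 / 2 * (ζ * (γ + ρ / (p.lam * n))) := fun s => by rw [ascent]; ring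
  have hstep : p.stepSize γ ρ ζ α i = if ζ * (γ + ρ / (p.lam * n)) = 0 then 1
    else min 1 ((p.gap α i + γ / 2 * ζ) / (ζ * (γ + ρ / (p.lam * n)))) := rfl
  have hb : 0 ≤ ζ * (γ + ρ / (p.lam * n)) := by positivity
  have ha : 0 ≤ p.gap α i + γ / 2 * ζ := by positivity
  simp only [hA]
  rw [hstep]
  generalize ζ * (γ + ρ / (p.lam * n)) = b at *
  generalize p.gap α i + γ / 2 * ζ = a at *
  split_ifs with h0
  · subst h0
    refine ⟨by simp, fun s hs => ?_⟩
    nlinarith [hs.2]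
  · have hb' : 0 < b := lt_of_le_of_ne hb (Ne.symm h0)
    refine ⟨⟨le_min zero_le_one (by positivity), min_le_left _ _⟩, fun s hs => ?_⟩
    rcases le_total 1 (a / b) with h1 | h1
    · rw [min_eq_left h1]
      rw [le_div_iff₀ hb'] at h1
      nlinarith [hs.1, hs.2, mul_nonneg (sub_nonneg.2 hs.2) (sub_nonneg.2 h1),
        mul_nonneg hb (sq_nonneg (1 - s))]
    · rw [min_eq_right h1]
      have : a / b * b = a := div_mul_cancel₀ _ h0
      set t := a / b
      rw [← this]
      nlinarith [mul_nonneg hb (sq_nonneg (t - s))]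

lemma Regular.ascent_mono_rho (hp : p.Regular) {γ ρ ρ' ζ Γ s : ℝ} (hζ : 0 ≤ ζ) (h : ρ ≤ ρ') :
    p.ascent γ ρ' ζ Γ s ≤ p.ascent γ ρ ζ Γ s := by
  have hn : (0 : ℝ) < n := by exact_mod_cast hp.n_pos
  have hl := hp.lam_pos
  have : s ^ 2 * ρ / (p.lam * n) ≤ s ^ 2 * ρ' / (p.lam * n) := by gcongr
  rw [ascent, ascent]
  have := mul_le_mul_of_nonneg_left this (by positivity : 0 ≤ ζ / 2)
  linarith

/-- With γ = 0 the coefficient of ζ is nonpositive, so overestimating z² only weakens the bound; a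
positive γ would spoil this. -/
lemma Regular.ascent_mono_zeta (hp : p.Regular) {ρ ζ ζ' Γ s : ℝ} (hρ : 0 ≤ ρ) (h : ζ ≤ ζ') :
    p.ascent 0 ρ ζ' Γ s ≤ p.ascent 0 ρ ζ Γ s := by
  have hn : (0 : ℝ) < n := by exact_mod_cast hp.n_pos
  have hl := hp.lam_pos
  have h0 : 0 ≤ s ^ 2 * ρ / (p.lam * n) := by positivity
  rw [ascent, ascent]
  have := mul_le_mul_of_nonneg_right h h0
  linarith

/-- Every option does at least as well as the step of size `s` along some dual direction `u`, with
`(u - αᵢ)²` possibly overestimated for Lipschitz losses; for smooth losses `s` is the fixed step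
size. -/
lemma Regular.option_bound (hp : p.Regular) {R : ℝ} {c : LossClass} {α : Fin n → ℝ}
    (h : p.Feasible α) {i : Fin n} {δ : ℝ} (hγ : 0 ≤ c.gamma) (hφ : ConjStrong c.gamma (p.φ i))
    (hconv : ConvexOn ℝ Set.univ (p.φ i)) (hR : normD' (p.x i) ≤ R)
    (hd : ∀ γ, c = .smooth γ → Differentiable ℝ (p.φ i))
    (hδ : p.OptionStep normD' R c α i δ) {s : ℝ} (hs : s ∈ Set.Icc (0 : ℝ) 1)
    (hV : ∀ γ, c = .smooth γ → s = p.lam * n * γ / (R ^ 2 + p.lam * n * γ)) :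
    ∃ u ζ, p.IsDualDirection α i u ∧ 0 ≤ ζ ∧
      (ζ = (u - α i) ^ 2 ∨ ∃ L, c = .lipschitz L ∧ ζ ≤ 4 * L ^ 2) ∧
      ((p.ascent c.gamma (R ^ 2) ζ (p.gap α i) s - (conj (p.φ i) (-α i)).toReal : ℝ) : EReal)
        ≤ p.proxObj normD' α i δ := by
  have hN : 0 ≤ normD' (p.x i) := mul_nonneg kappa_pos.le (linf_nonneg _)
  have hρ : normD' (p.x i) ^ 2 ≤ R ^ 2 := pow_le_pow_left₀ hN hR 2
  have coe_mono : ∀ {a b : ℝ}, a ≤ b → ((a - (conj (p.φ i) (-α i)).toReal : ℝ) : EReal)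
      ≤ ((b - (conj (p.φ i) (-α i)).toReal : ℝ) : EReal) :=
    fun hab => EReal.coe_le_coe_iff.2 (by linarith)
  have basic : ∀ u, p.IsDualDirection α i u → ∀ s ∈ Set.Icc (0 : ℝ) 1,
      ((p.ascent c.gamma (R ^ 2) ((u - α i) ^ 2) (p.gap α i) s
        - (conj (p.φ i) (-α i)).toReal : ℝ) : EReal) ≤ p.proxObj normD' α i (s * (u - α i)) :=
    fun u hu s hs => (coe_mono (hp.ascent_mono_rho (sq_nonneg _) hρ)).trans
      (hp.le_proxObj h hφ hu hs)
  cases hδ with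
  | optionI _ hmax =>
    -- This option names no direction; a global maximizer is compared with the step along any
    -- subgradient.
    obtain ⟨u, hu⟩ := exists_isSubgradient hconv (inner ℝ (p.x i) (p.w α))
    have hu' : p.IsDualDirection α i (-u) := by rw [IsDualDirection, neg_neg]; exact hu
    exact ⟨-u, _, hu', sq_nonneg _, Or.inl rfl,
      (basic _ hu' s hs).trans (hmax (Set.mem_univ _))⟩
  | optionII u s' hu hs' hmax =>
    exact ⟨u, _, hu, sq_nonneg _, Or.inl rfl, (basic u hu s hs).trans (hmax hs)⟩
  | optionIII u hu =>
    obtain ⟨h1, h2⟩ := ascent_le_ascent_stepSize hp hγ (sq_nonneg (normD' (p.x i)))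
      (sq_nonneg (u - α i)) h i
    exact ⟨u, _, hu, sq_nonneg _, Or.inl rfl,
      (coe_mono ((hp.ascent_mono_rho (sq_nonneg _) hρ).trans (h2 s hs))).trans
        (hp.le_proxObj h hφ hu h1)⟩
  | optionIV u hu =>
    obtain ⟨h1, h2⟩ := ascent_le_ascent_stepSize hp hγ (sq_nonneg R) (sq_nonneg (u - α i)) h i
    exact ⟨u, _, hu, sq_nonneg _, Or.inl rfl, (coe_mono (h2 s hs)).trans (basic u hu _ h1)⟩
  | optionIVLip L u ζ hc hu hζ₁ hζ₂ =>
    have hζ : 0 ≤ ζ := (sq_nonneg _).trans hζ₁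
    obtain ⟨h1, h2⟩ := ascent_le_ascent_stepSize hp hγ (sq_nonneg R) hζ h i
    -- The step size is optimal for the ζ-bound, whereas the actual increase is governed by z² ≤ ζ.
    refine ⟨u, ζ, hu, hζ, Or.inr ⟨L, hc, hζ₂⟩, (coe_mono ((h2 s hs).trans ?_)).trans
      (basic u hu _ h1)⟩
    subst hc
    exact hp.ascent_mono_zeta (sq_nonneg R) hζ₁
  | optionV γ hc =>
    have hu' : p.IsDualDirection α i (-deriv (p.φ i) (inner ℝ (p.x i) (p.w α))) := by
      rw [IsDualDirection, neg_neg]; exact isSubgradient_deriv hconv (hd γ hc) _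
    refine ⟨_, _, hu', sq_nonneg _, Or.inl rfl, ?_⟩
    rw [← hV γ hc]
    exact basic _ hu' s hs

lemma Regular.step_dualReal (hp : p.Regular) {R e : ℝ} {c : LossClass} {α α' : Fin n → ℝ}
    (h : p.Feasible α) {i : Fin n} (hstep : p.Step normD' R c α i α')
    (he : ∀ δ, p.OptionStep normD' R c α i δ →
      ((e - (conj (p.φ i) (-α i)).toReal : ℝ) : EReal) ≤ p.proxObj normD' α i δ) :
    p.Feasible α' ∧ p.dualReal α + e / n ≤ p.dualReal α' := by
  obtain ⟨δ, δ', -, hopt, hle⟩ := hstep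
  obtain ⟨h1, h2⟩ := hp.dualReal_update h i (he δ' hopt)
  rw [dual_eq_dualReal h1] at hle
  have h3 := hp.feasible_of_le_dual hle
  rw [dual_eq_dualReal h3, EReal.coe_le_coe_iff] at hle
  exact ⟨h3, h2.trans hle⟩

/-- One iteration for smooth losses. -/
lemma Regular.step_smooth (hp : p.Regular) {R γ : ℝ} (hγ : 0 < γ) {α α' : Fin n → ℝ}
    (h : p.Feasible α) {i : Fin n} (hφ : IsSmooth γ (p.φ i))
    (hconv : ConvexOn ℝ Set.univ (p.φ i)) (hR : normD' (p.x i) ≤ R)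
    (hstep : p.Step normD' R (.smooth γ) α i α') :
    p.Feasible α' ∧ p.dualReal α
      + p.lam * n * γ / (R ^ 2 + p.lam * n * γ) * p.gap α i / n ≤ p.dualReal α' := by
  have hn : (0 : ℝ) < n := by exact_mod_cast hp.n_pos
  have hl := hp.lam_pos
  refine hp.step_dualReal h hstep fun δ hδ => ?_
  have hpos : 0 < p.lam * n * γ := by positivity
  have hs : p.lam * n * γ / (R ^ 2 + p.lam * n * γ) ∈ Set.Icc (0 : ℝ) 1 :=
    ⟨by positivity, (div_le_one (by positivity)).2 (by linarith [sq_nonneg R])⟩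
  obtain ⟨u, ζ, -, -, -, hle⟩ := hp.option_bound (c := .smooth γ) h hγ.le
    (conjStrong_of_isSmooth hγ hφ) hconv hR (fun _ _ => hφ.1) hδ hs (fun γ' hc => by cases hc; rfl)
  refine le_trans (le_of_eq ?_) hle
  -- For this s one has γ(1 - s) = sR²/(λn): the quadratic part vanishes for every ζ, leaving s
  -- times the gap.
  congr 2
  have hden : R ^ 2 + p.lam * n * γ ≠ 0 := by positivity
  simp only [ascent, LossClass.gamma]
  field_simp
  ring

/-- One iteration for Lipschitz losses. -/
lemma Regular.step_lipschitz (hp : p.Regular) {R L : ℝ} {α α' : Fin n → ℝ}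
    (h : p.Feasible α) {i : Fin n} (hφ : IsLip L (p.φ i))
    (hconv : ConvexOn ℝ Set.univ (p.φ i)) (hR : normD' (p.x i) ≤ R)
    (hstep : p.Step normD' R (.lipschitz L) α i α') {s : ℝ} (hs : s ∈ Set.Icc (0 : ℝ) 1) :
    p.Feasible α' ∧ p.dualReal α
      + (s * p.gap α i - s ^ 2 * (2 * L ^ 2 * R ^ 2) / (p.lam * n)) / n ≤ p.dualReal α' := by
  have hn : (0 : ℝ) < n := by exact_mod_cast hp.n_pos
  have hl := hp.lam_pos
  refine hp.step_dualReal h hstep fun δ hδ => ?_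
  obtain ⟨u, ζ, hu, hζ0, hζ, hle⟩ := hp.option_bound (c := .lipschitz L) h le_rfl
    (conjStrong_zero _) hconv hR (fun γ' hc => by cases hc) hδ hs (fun γ' hc => by cases hc)
  have hζ' : ζ ≤ 4 * L ^ 2 := by
    rcases hζ with rfl | ⟨L', hL', hζ⟩
    · have h1 := hφ.abs_le_of_conj_le hu.conj_le
      have h2 := hφ.abs_le_of_conj_le (coe_toReal_conj (h i)).ge
      rw [abs_neg, abs_le] at h1 h2
      nlinarith
    · cases hL'; exact hζ
  refine le_trans (EReal.coe_le_coe_iff.2 ?_) hle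
  have := hp.ascent_mono_zeta (Γ := p.gap α i) (s := s) (sq_nonneg R) hζ'
  have e : p.ascent 0 (R ^ 2) (4 * L ^ 2) (p.gap α i) s
      = s * p.gap α i - s ^ 2 * (2 * L ^ 2 * R ^ 2) / (p.lam * n) := by rw [ascent]; ring
  rw [e] at this
  simp only [LossClass.gamma]
  linarith

end Problem

end ProxSDCA

end

noncomputable section

namespace ProxSDCA

/-! ### Expectations over the picked indices -/

/-- Expectation of `f` at the list of the first `t` picked indices. -/
def histExp (n : ℕ) (t : ℕ) (f : List (Fin n) → ℝ) : ℝ := 𝔼 ω : Fin t → Fin n, f (List.ofFn ω)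

section

variable {n : ℕ}

lemma histExp_zero (f : List (Fin n) → ℝ) : histExp n 0 f = f [] := by
  simp [histExp]

/-- Conditioning on the history: the last pick is averaged out first. -/
lemma histExp_succ (t : ℕ) (f : List (Fin n) → ℝ) :
    histExp n (t + 1) f = histExp n t fun h => 𝔼 i, f (h ++ [i]) := by
  rw [histExp, ← Fintype.expect_equiv (Fin.snocEquiv fun _ => Fin n)
    (fun x : Fin n × (Fin t → Fin n) => f (List.ofFn x.2 ++ [x.1]))]
  · rw [← Finset.univ_product_univ, Finset.expect_product, Finset.expect_comm, histExp]
  · intro x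
    rw [List.ofFn_succ_last]
    simp [Fin.snocEquiv]

lemma histExp_mono {t : ℕ} {f g : List (Fin n) → ℝ} (h : ∀ l, f l ≤ g l) :
    histExp n t f ≤ histExp n t g :=
  Finset.expect_le_expect fun _ _ => h _

lemma histExp_add (t : ℕ) (f g : List (Fin n) → ℝ) :
    histExp n t (fun l => f l + g l) = histExp n t f + histExp n t g :=
  Finset.expect_add_distrib _ _ _

lemma histExp_sub (t : ℕ) (f g : List (Fin n) → ℝ) :
    histExp n t (fun l => f l - g l) = histExp n t f - histExp n t g :=
  Finset.expect_sub_distrib _ _ _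

lemma histExp_mul (t : ℕ) (c : ℝ) (f : List (Fin n) → ℝ) :
    histExp n t (fun l => c * f l) = c * histExp n t f :=
  (Finset.mul_expect _ _ _).symm

lemma histExp_const [NeZero n] (t : ℕ) (c : ℝ) : histExp n t (fun _ => c) = c :=
  Finset.expect_const Finset.univ_nonempty c

lemma expect_take [NeZero n] {t T : ℕ} (h : t ≤ T) (f : List (Fin n) → ℝ) :
    𝔼 ω : Fin T → Fin n, f ((List.ofFn ω).take t) = histExp n t f := by
  induction T, h using Nat.le_induction with
  | base =>
    exact Finset.expect_congr rfl fun ω _ => by rw [List.take_of_length_le (by simp)]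
  | succ T hT ih =>
    change histExp n (T + 1) (fun l => f (l.take t)) = _
    rw [histExp_succ, ← ih]
    refine Finset.expect_congr rfl fun ω _ => ?_
    rw [← Finset.expect_const (s := (Finset.univ : Finset (Fin n))) Finset.univ_nonempty
      (f ((List.ofFn ω).take t))]
    exact Finset.expect_congr rfl fun i _ => by
      rw [List.take_append_of_le_length (by simpa using hT)]

end

namespace Problem

variable {n d : ℕ} {p : Problem n d}

lemma expLast_eq [NeZero n] (F : Vec d → ℝ) (a : List (Fin n) → Fin n → ℝ) (T : ℕ) :
    p.expLast F a T = histExp n T fun l => F (p.w (a l)) :=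
  expect_take le_rfl fun l => F (p.w (a l))

lemma expRandom_eq [NeZero n] (F : Vec d → ℝ) (a : List (Fin n) → Fin n → ℝ) {T₀ T : ℕ}
    (h : T₀ < T) :
    p.expRandom F a T₀ T
      = (∑ t ∈ Finset.Ico (T₀ + 1) (T + 1), histExp n t fun l => F (p.w (a l))) / ((T : ℝ) - T₀) := by
  rw [expRandom, Finset.expect_comm, Finset.expect_eq_sum_div_card, Nat.card_Ioc,
    Nat.cast_sub h.le]
  congr 1
  refine Finset.sum_congr (by ext; simp) fun t ht => ?_
  exact expect_take (by simp at ht; omega) fun l => F (p.w (a l))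

/-- Jensen for the average, then each iterate sees only the picks made before it. -/
lemma expAvg_le [NeZero n] {F : Vec d → ℝ} (hF : ConvexOn ℝ Set.univ F)
    (a : List (Fin n) → Fin n → ℝ) {T₀ T : ℕ} (h : T₀ < T) :
    p.expAvg F a T₀ T
      ≤ (∑ t ∈ Finset.Ico T₀ T, histExp n t fun l => F (p.w (a l))) / ((T : ℝ) - T₀) := by
  have hpos : (0 : ℝ) < (T : ℝ) - T₀ := by
    have : (T₀ : ℝ) < T := by exact_mod_cast h
    linarith
  have h1 : ∀ ω : Fin T → Fin n, F (p.avgOutput a T₀ ω)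
      ≤ ∑ t ∈ Finset.Ico T₀ T, 1 / ((T : ℝ) - T₀) * F (p.iterate a ω t) := by
    intro ω
    rw [avgOutput, Finset.smul_sum]
    refine hF.map_sum_le (fun _ _ => by positivity) ?_ (fun _ _ => Set.mem_univ _)
    rw [Finset.sum_const, Nat.card_Ico, nsmul_eq_mul, Nat.cast_sub h.le, mul_one_div,
      div_self hpos.ne']
  refine (Finset.expect_le_expect fun ω _ => h1 ω).trans (le_of_eq ?_)
  rw [Finset.expect_sum_comm, Finset.sum_div]
  refine Finset.sum_congr rfl fun t ht => ?_
  rw [← Finset.mul_expect, one_div, inv_mul_eq_div]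
  congr 1
  exact expect_take (by simp at ht; omega) fun l => F (p.w (a l))

/-- The recursion satisfied along a run by the expected dual suboptimality `A` and the expected
duality gap `G`. -/
lemma Regular.exists_recursion (hp : p.Regular) (hφ : ∀ i z, 0 ≤ p.φ i z)
    (hφ0 : 1 / (n : ℝ) * ∑ i, p.φ i 0 ≤ 1) {R s k : ℝ} {c : LossClass}
    (hstep : ∀ α α' i, p.Feasible α → p.Step normD' R c α i α' →
      p.Feasible α' ∧ p.dualReal α + (s * p.gap α i - k) / n ≤ p.dualReal α')
    {a : List (Fin n) → Fin n → ℝ} (ha : p.IsRun normD' R c a) :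
    ∃ A G : ℕ → ℝ, A 0 ≤ 1 ∧ (∀ t, 0 ≤ A t) ∧ (∀ t, A t ≤ G t) ∧
      (∀ t, A (t + 1) ≤ A t - s / n * G t + k / n) ∧
      ∀ t w, (histExp n t fun l => p.primal (p.w (a l))) ≤ p.primal w + G t := by
  have : NeZero n := ⟨hp.n_pos.ne'⟩
  have hn : (0 : ℝ) < n := by exact_mod_cast hp.n_pos
  have conj0 : ∀ i, conj (p.φ i) (-(0 : Fin n → ℝ) i) ≤ ((0 : ℝ) : EReal) := by
    intro i
    rw [conj_le_iff]
    intro z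
    simpa using hφ i z
  have feas : ∀ l, p.Feasible (a l) := by
    intro l
    induction l using List.reverseRecOn with
    | nil =>
      rw [ha.init]
      exact fun i => ne_top_of_le_ne_top (EReal.coe_ne_top _) (conj0 i)
    | append_singleton l i ih => exact (hstep _ _ i ih (ha.step l i)).1
  have primal_nonneg : ∀ w, 0 ≤ p.primal w := fun w =>
    add_nonneg (mul_nonneg (by positivity) (Finset.sum_nonneg fun i _ => hφ i _))
      (mul_nonneg hp.lam_pos.le (hp.reg.nonneg w))
  have bdd : BddBelow (Set.range p.primal) := ⟨0, by rintro _ ⟨w, rfl⟩; exact primal_nonneg w⟩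
  -- Suboptimality is measured against the primal infimum, so weak duality suffices and no dual
  -- optimum is needed.
  set U := ⨅ w, p.primal w with hU
  have U_le : ∀ w, U ≤ p.primal w := fun w => ciInf_le bdd w
  have le_U : ∀ l, p.dualReal (a l) ≤ U := fun l =>
    le_ciInf fun w => hp.dualReal_le_primal (feas l) w
  have dual0 : 0 ≤ p.dualReal (a []) := by
    rw [ha.init, dualReal]
    have h1 : 0 ≤ ∑ i, -(conj (p.φ i) (-(0 : Fin n → ℝ) i)).toReal :=
      Finset.sum_nonneg fun i _ => neg_nonneg.2 (toReal_conj_le (conj0 i))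
    have h2 : conjVec p.g (p.v 0) ≤ 0 := by
      refine ciSup_le fun w => ?_
      have := hp.reg.nonneg w
      simp [v, this]
    have h3 := mul_nonneg (by positivity : (0 : ℝ) ≤ 1 / n) h1
    have h4 := mul_nonneg hp.lam_pos.le (neg_nonneg.2 h2)
    linarith
  have U_le_one : U ≤ 1 := by
    refine (U_le 0).trans ?_
    simpa [primal, hp.reg.zero] using hφ0
  refine ⟨fun t => U - histExp n t fun l => p.dualReal (a l),
    fun t => histExp n t fun l => p.primal (p.w (a l)) - p.dualReal (a l), ?_, ?_, ?_, ?_, ?_⟩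
  · simp only [histExp_zero]
    linarith
  · intro t
    have := histExp_mono (t := t) le_U
    rw [histExp_const] at this
    linarith
  · intro t
    have := histExp_mono (t := t) fun l => U_le (p.w (a l))
    rw [histExp_const] at this
    simp only [histExp_sub]
    linarith
  · intro t
    -- Averaging over the picked index turns the single-example gaps into the full duality gap.
    have key : ∀ l, p.dualReal (a l) + (s / n * (p.primal (p.w (a l)) - p.dualReal (a l)) - k / n)
        ≤ 𝔼 i, p.dualReal (a (l ++ [i])) := by
      intro l
      have h1 : 𝔼 i, (p.dualReal (a l) + (s * p.gap (a l) i - k) / n)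
          ≤ 𝔼 i, p.dualReal (a (l ++ [i])) :=
        Finset.expect_le_expect fun i _ => (hstep _ _ i (feas l) (ha.step l i)).2
      refine le_trans (le_of_eq ?_) h1
      rw [hp.primal_sub_dualReal, Finset.expect_eq_sum_div_card, Finset.sum_add_distrib,
        ← Finset.sum_div, Finset.sum_sub_distrib, ← Finset.mul_sum]
      simp only [Finset.sum_const, Finset.card_univ, Fintype.card_fin, nsmul_eq_mul]
      field_simp
    have h2 := histExp_mono (t := t) key
    rw [← histExp_succ t fun l => p.dualReal (a l), histExp_add, histExp_sub, histExp_const, histExp_mul] at h2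
    linarith
  · intro t w
    have := histExp_mono (t := t) le_U
    rw [histExp_const] at this
    have := U_le w
    simp only [histExp_sub]
    linarith

end Problem

/-! ### Solving the recursion -/

section

variable {A G : ℕ → ℝ} {τ k : ℝ}

/-- Since G ≥ A, each step contracts by 1 - 1/τ ≤ e^(-1/τ), and kτ is the fixed point of the noisy
recursion. -/
lemma le_exp_add_of_recursion (hτ : 1 ≤ τ) (h0 : A 0 ≤ 1) (hk : 0 ≤ k) (hAG : ∀ t, A t ≤ G t)
    (hrec : ∀ t, A (t + 1) ≤ A t - 1 / τ * G t + k) (t : ℕ) :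
    A t ≤ Real.exp (-(t / τ)) + k * τ := by
  have τ0 : 0 < τ := by linarith
  have hτ' : 1 / τ ≤ 1 := (div_le_one τ0).2 hτ
  induction t with
  | zero =>
    have : 0 ≤ k * τ := by positivity
    simp
    linarith
  | succ t ih =>
    have h1 := mul_le_mul_of_nonneg_left (hAG t) (by positivity : 0 ≤ 1 / τ)
    have h2 := mul_le_mul_of_nonneg_left ih (sub_nonneg.2 hτ')
    have h3 : (1 - 1 / τ) * Real.exp (-(t / τ)) ≤ Real.exp (-((t + 1 : ℕ) / τ)) := by
      have e : Real.exp (-((t + 1 : ℕ) / τ)) = Real.exp (-(1 / τ)) * Real.exp (-(t / τ)) := by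
        rw [← Real.exp_add]; congr 1; push_cast; ring
      rw [e]
      exact mul_le_mul_of_nonneg_right (Real.one_sub_le_exp_neg _) (Real.exp_pos _).le
    have h4 : 1 / τ * (k * τ) = k := by field_simp
    have := hrec t
    linarith

/-- A gap G(t) forces a decrease of G(t)/τ, which cannot exceed A(t). -/
lemma gap_le_of_recursion (hτ : 1 ≤ τ) (h0 : A 0 ≤ 1) (hA : ∀ t, 0 ≤ A t) (hAG : ∀ t, A t ≤ G t)
    (hrec : ∀ t, A (t + 1) ≤ A t - 1 / τ * G t) (t : ℕ) : G t ≤ τ * Real.exp (-(t / τ)) := by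
  have τ0 : 0 < τ := by linarith
  have h1 := le_exp_add_of_recursion hτ h0 le_rfl hAG (fun t => by linarith [hrec t]) t
  have h2 : 1 / τ * G t ≤ Real.exp (-(t / τ)) := by linarith [hrec t, hA (t + 1)]
  have h3 := mul_le_mul_of_nonneg_left h2 τ0.le
  rwa [← mul_assoc, mul_one_div, div_self τ0.ne', one_mul] at h3

/-- The decreases of A telescope. -/
lemma sum_gap_le_of_recursion (hτ : 0 < τ) (hA : ∀ t, 0 ≤ A t)
    (hrec : ∀ t, A (t + 1) ≤ A t - 1 / τ * G t + k) {T₀ T : ℕ} (h : T₀ ≤ T) :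
    ∑ t ∈ Finset.Ico T₀ T, G t ≤ τ * A T₀ + ((T : ℝ) - T₀) * (k * τ) := by
  have key : ∑ t ∈ Finset.Ico T₀ T, G t ≤ τ * (A T₀ - A T) + ((T : ℝ) - T₀) * (k * τ) := by
    induction T, h using Nat.le_induction with
    | base => simp
    | succ T hT ih =>
      rw [Finset.sum_Ico_succ_top hT]
      have h1 := mul_le_mul_of_nonneg_left (hrec T) hτ.le
      have h2 : τ * (A T - 1 / τ * G T + k) = τ * A T - G T + k * τ := by field_simp
      rw [h2] at h1
      push_cast
      linarith
  nlinarith [hA T]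

end

end ProxSDCA

end

namespace ProxSDCA

/-! ### The `ℓ¹` problem -/

section

variable {n d : ℕ} {x : Fin n → Vec d} {φ : Fin n → ℝ → ℝ} {σ ε B : ℝ}

lemma convexOn_l1Objective (hconv : ∀ i, ConvexOn ℝ Set.univ (φ i)) (hσ : 0 ≤ σ) :
    ConvexOn ℝ Set.univ (l1Objective x φ σ) := by
  refine ⟨convex_univ, fun u _ v _ a b ha hb hab => ?_⟩
  have h1 : ∑ i, φ i (inner ℝ (x i) (a • u + b • v))
      ≤ ∑ i, (a * φ i (inner ℝ (x i) u) + b * φ i (inner ℝ (x i) v)) :=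
    Finset.sum_le_sum fun i _ => by
      rw [inner_add_right, inner_smul_right, inner_smul_right]
      exact (hconv i).2 (Set.mem_univ _) (Set.mem_univ _) ha hb hab
  have h2 := l1_add_le (a • u) (b • v)
  rw [l1_smul, l1_smul, abs_of_nonneg ha, abs_of_nonneg hb] at h2
  have h3 := mul_le_mul_of_nonneg_left h1 (by positivity : (0 : ℝ) ≤ 1 / n)
  have h4 := mul_le_mul_of_nonneg_left h2 hσ
  rw [Finset.sum_add_distrib, ← Finset.mul_sum, ← Finset.mul_sum] at h3
  simp only [l1Objective, smul_eq_mul]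
  linarith

lemma lamChoice_pos (hd : 8 ≤ d) (hε : 0 < ε) (hB : 0 < B) : 0 < lamChoice d ε B := by
  have := two_lt_log hd
  rw [lamChoice]
  positivity

lemma qProblem_regular (hn : 1 ≤ n) (hd : 8 ≤ d) (hσ : 0 < σ) (hε : 0 < ε) (hB : 0 < B) :
    (qProblem x φ σ ε B).Regular :=
  ⟨hn, lamChoice_pos hd hε hB, gChoice_strongReg hd hσ (lamChoice_pos hd hε hB)⟩

lemma qProblem_primal (hd : 8 ≤ d) (hε : 0 < ε) (hB : 0 < B) (w : Vec d) :
    (qProblem x φ σ ε B).primal w = l1Objective x φ σ w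
      + ε / (2 * B ^ 2) * lq (Real.log d / (Real.log d - 1)) w ^ 2 := by
  have hl := two_lt_log hd
  have h1 := lamChoice_pos hd hε hB
  have h2 : lamChoice d ε B * (3 * Real.log d / 2) = ε / (2 * B ^ 2) := by
    rw [lamChoice]; field_simp
  simp only [Problem.primal, qProblem, gChoice, l1Objective]
  rw [← h2]
  field_simp
  ring

lemma l1Objective_le_primal (hd : 8 ≤ d) (hε : 0 < ε) (hB : 0 < B) (w : Vec d) :
    l1Objective x φ σ w ≤ (qProblem x φ σ ε B).primal w := by
  rw [qProblem_primal hd hε hB]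
  have : 0 ≤ ε / (2 * B ^ 2) * lq (Real.log d / (Real.log d - 1)) w ^ 2 := by positivity
  linarith

lemma primal_le_l1Objective_add (hd : 8 ≤ d) (hε : 0 < ε) (hB : 0 < B) {w : Vec d}
    (hw : l1 w ≤ B) : (qProblem x φ σ ε B).primal w ≤ l1Objective x φ σ w + ε / 2 := by
  have hl := two_lt_log hd
  rw [qProblem_primal hd hε hB]
  have hq : 1 ≤ Real.log d / (Real.log d - 1) := by rw [one_le_div (by linarith)]; linarith
  have h1 : lq (Real.log d / (Real.log d - 1)) w ^ 2 ≤ B ^ 2 :=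
    pow_le_pow_left₀ (lq_nonneg _ _) ((lq_le_l1 hq w).trans hw) 2
  have h2 : ε / (2 * B ^ 2) * B ^ 2 = ε / 2 := by field_simp
  have h3 := mul_le_mul_of_nonneg_left h1 (by positivity : 0 ≤ ε / (2 * B ^ 2))
  linarith

end

/-! ### Numerical constants and accuracy bounds -/

lemma exp_one_sq_lt : Real.exp 1 ^ 2 < 7.5 := by
  nlinarith [Real.exp_one_lt_d9, Real.exp_pos 1]

lemma log_sixteen_lt : Real.log 16 < 3 := by
  rw [show (16 : ℝ) = 2 ^ 4 by norm_num, Real.log_pow]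
  push_cast
  linarith [Real.log_two_lt_d9]

lemma exp_neg_div_le {τ y t : ℝ} (hτ : 0 < τ) (hy : 0 < y) (h : τ * Real.log y ≤ t) :
    Real.exp (-(t / τ)) ≤ 1 / y := by
  rw [one_div, ← Real.exp_log hy, ← Real.exp_neg, Real.exp_le_exp, neg_le_neg_iff,
    le_div_iff₀ hτ]
  linarith

/-- The factor 3 comes from log 16 < 3. It is used with c = 8 (smooth) and c = 120 (Lipschitz), so C
= 1000 leaves room. -/
lemma mul_log_le_tildeO {M ε τ y C c : ℝ} (hM : 1 ≤ M) (hε : 0 < ε) (hτ0 : 0 ≤ τ) (hτ : τ ≤ c * M)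
    (hC : 3 * c ≤ C) (hy : 0 < y) (hyM : y ≤ 16 * (1 + M / ε)) :
    τ * Real.log y ≤ tildeO C M ε := by
  have h0 : 0 < M / ε := by positivity
  have hpos : 0 ≤ Real.log (1 + M / ε) := Real.log_nonneg (by linarith)
  have h1 : Real.log y ≤ 3 * (1 + Real.log (1 + M / ε)) := by
    have := Real.log_le_log hy hyM
    rw [Real.log_mul (by norm_num) (by positivity)] at this
    linarith [log_sixteen_lt]
  calc τ * Real.log y ≤ τ * (3 * (1 + Real.log (1 + M / ε))) := by gcongr
    _ ≤ c * M * (3 * (1 + Real.log (1 + M / ε))) := by gcongr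
    _ = 3 * c * M * (1 + Real.log (1 + M / ε)) := by ring
    _ ≤ _ := by rw [tildeO]; gcongr

/-- The expected accuracy at each single iterate, smooth losses. -/
lemma smooth_iterate_bound {n d : ℕ} {x : Fin n → Vec d} {φ : Fin n → ℝ → ℝ} {σ ε B R γ : ℝ}
    {wstar : Vec d} (hn : 1 ≤ n) (hd : 8 ≤ d) (hσ : 0 < σ) (hε : 0 < ε) (hB : 0 < B)
    (hconv : ∀ i, ConvexOn ℝ Set.univ (φ i)) (hφ : ∀ i a, 0 ≤ φ i a)
    (hφ0 : 1 / (n : ℝ) * ∑ i, φ i 0 ≤ 1) (hR : ∀ i, linf (x i) ≤ R) (hw : l1 wstar ≤ B)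
    (hγ : 0 < γ) (hsm : ∀ i, IsSmooth γ (φ i)) {a : List (Fin n) → Fin n → ℝ}
    (ha : IsQRun x φ σ ε B R (.smooth γ) a) {t : ℕ}
    (ht : tildeO 1000 (n + R ^ 2 * B ^ 2 * Real.log d / (ε * γ)) ε ≤ t) :
    (histExp n t fun l => l1Objective x φ σ ((qProblem x φ σ ε B).w (a l)))
      ≤ l1Objective x φ σ wstar + ε := by
  have hl := two_lt_log hd
  have hp := qProblem_regular (x := x) (φ := φ) hn hd hσ hε hB
  have hlam := lamChoice_pos hd hε hB
  have hn1 : (1 : ℝ) ≤ n := by exact_mod_cast hn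
  set p := qProblem x φ σ ε B with hpdef
  set lam := lamChoice d ε B with hlamdef
  have hplam : p.lam = lam := rfl
  set X := R ^ 2 * B ^ 2 * Real.log d / (ε * γ) with hX
  have X0 : 0 ≤ X := by positivity
  set s := lam * n * γ / ((kappa * R) ^ 2 + lam * n * γ) with hs
  -- Chosen so that s/n = 1/τ: the definitions of λ and κ give (κR)²/(λγ) = e²X.
  set τ := n + Real.exp 1 ^ 2 * X with hτ
  have hsτ : s / n = 1 / τ := by
    have : (kappa * R) ^ 2 = lam * γ * (Real.exp 1 ^ 2 * X) := by
      rw [mul_pow, kappa_sq, hX, hlamdef, lamChoice]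
      field_simp
    rw [hs, hτ, this, show lam * γ * (Real.exp 1 ^ 2 * X) + lam * n * γ
      = lam * γ * (n + Real.exp 1 ^ 2 * X) by ring]
    have : 0 < n + Real.exp 1 ^ 2 * X := by positivity
    field_simp
  obtain ⟨A, G, h0, hA, hAG, hrec, hE⟩ := hp.exists_recursion (s := s) (k := 0) hφ hφ0
    (fun α α' i hα hst => by
      have := hp.step_smooth hγ hα (hsm i) (hconv i)
        (mul_le_mul_of_nonneg_left (hR i) kappa_pos.le) hst
      rwa [sub_zero]) ha
  have τ1 : 1 ≤ τ := by
    have : 0 ≤ Real.exp 1 ^ 2 * X := by positivity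
    linarith
  have τ0 : 0 < τ := by linarith
  have hG := gap_le_of_recursion τ1 h0 hA hAG
    (fun t => by have := hrec t; rw [hsτ] at this; simpa using this) t
  have hτM : τ ≤ 8 * (n + X) := by
    have := mul_le_mul_of_nonneg_right exp_one_sq_lt.le X0
    linarith
  have hy : 2 * τ / ε ≤ 16 * (1 + (n + X) / ε) := by
    have : 2 * τ / ε ≤ 2 * (8 * (n + X)) / ε := by gcongr
    have e : 2 * (8 * (n + X)) / ε = 16 * ((n + X) / ε) := by ring
    linarith
  -- With y = 2τ/ε the gap bound τ·e^(-t/τ) drops to ε/2; the regularizer uses the other half.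
  have h1 := exp_neg_div_le (t := t) τ0 (by positivity : 0 < 2 * τ / ε)
    ((mul_log_le_tildeO (by linarith) hε τ0.le hτM (by norm_num)
      (by positivity) hy).trans ht)
  have h2 : τ * Real.exp (-(t / τ)) ≤ ε / 2 := by
    refine (mul_le_mul_of_nonneg_left h1 τ0.le).trans (le_of_eq ?_)
    field_simp
  have h3 := hE t wstar
  have h4 := primal_le_l1Objective_add (x := x) (φ := φ) (σ := σ) hd hε hB hw
  have h5 := histExp_mono (n := n) (t := t)
    fun l => l1Objective_le_primal (x := x) (φ := φ) (σ := σ) hd hε hB (p.w (a l))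
  linarith

/-- The expected accuracy averaged over a range of iterates, Lipschitz losses. -/
lemma lipschitz_average_bound {n d : ℕ} {x : Fin n → Vec d} {φ : Fin n → ℝ → ℝ} {σ ε B R L : ℝ}
    {wstar : Vec d} (hn : 1 ≤ n) (hd : 8 ≤ d) (hσ : 0 < σ) (hε : 0 < ε) (hB : 0 < B)
    (hconv : ∀ i, ConvexOn ℝ Set.univ (φ i)) (hφ : ∀ i a, 0 ≤ φ i a)
    (hφ0 : 1 / (n : ℝ) * ∑ i, φ i 0 ≤ 1) (hR : ∀ i, linf (x i) ≤ R) (hw : l1 wstar ≤ B)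
    (hlip : ∀ i, IsLip L (φ i)) {a : List (Fin n) → Fin n → ℝ}
    (ha : IsQRun x φ σ ε B R (.lipschitz L) a) {T₀ T : ℕ}
    (hT₀ : tildeO 1000 (n + L ^ 2 * R ^ 2 * B ^ 2 * Real.log d / ε ^ 2) ε ≤ T₀)
    (hT : T₀ + tildeO 1000 (n + L ^ 2 * R ^ 2 * B ^ 2 * Real.log d / ε ^ 2) ε ≤ T) :
    (∑ t ∈ Finset.Ico T₀ T,
        histExp n t fun l => l1Objective x φ σ ((qProblem x φ σ ε B).w (a l))) / ((T : ℝ) - T₀)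
      ≤ l1Objective x φ σ wstar + ε := by
  have hl := two_lt_log hd
  have hp := qProblem_regular (x := x) (φ := φ) hn hd hσ hε hB
  have hlam := lamChoice_pos hd hε hB
  have hn1 : (1 : ℝ) ≤ n := by exact_mod_cast hn
  set p := qProblem x φ σ ε B with hpdef
  set lam := lamChoice d ε B with hlamdef
  set X := L ^ 2 * R ^ 2 * B ^ 2 * Real.log d / ε ^ 2 with hX
  have X0 : 0 ≤ X := by positivity
  -- The noise level is 2e²Xε/τ; since 2e² < 15 = 120/8, it is at most ε/8.
  set τ := 120 * (n + X) with hτ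
  have τ1 : 1 ≤ τ := by linarith
  have τ0 : 0 < τ := by linarith
  set s := n / τ with hs
  have hs1 : s ∈ Set.Icc (0 : ℝ) 1 := ⟨by positivity, (div_le_one τ0).2 (by linarith)⟩
  have hsτ : s / n = 1 / τ := by rw [hs]; field_simp
  set k := s ^ 2 * (2 * L ^ 2 * (kappa * R) ^ 2) / (lam * n) with hk
  obtain ⟨A, G, h0, hA, hAG, hrec, hE⟩ := hp.exists_recursion (s := s) (k := k) hφ hφ0
    (fun α α' i hα hst => hp.step_lipschitz hα (hlip i) (hconv i)
        (mul_le_mul_of_nonneg_left (hR i) kappa_pos.le) hst hs1) ha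
  rw [hsτ] at hrec
  have hk0 : 0 ≤ k / n := by positivity
  have hkτ : k / n * τ ≤ ε / 8 := by
    have e : k / n * τ = 2 * Real.exp 1 ^ 2 * X * ε / τ := by
      rw [hk, hs, mul_pow kappa, kappa_sq, hX, hlamdef, lamChoice]
      field_simp
    rw [e, div_le_iff₀ τ0]
    have h1 := mul_le_mul_of_nonneg_right exp_one_sq_lt.le X0
    have h2 : 2 * Real.exp 1 ^ 2 * X ≤ τ / 8 := by linarith
    have h3 := mul_le_mul_of_nonneg_right h2 hε.le
    linarith
  have hMε : 0 < (n + X) / ε := by positivity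
  -- The burn-in brings the exponential term to ε/8, and the noise level adds another ε/8.
  have hAT : A T₀ ≤ ε / 4 := by
    have h1 := le_exp_add_of_recursion τ1 h0 hk0 hAG hrec T₀
    have hy : 8 / ε ≤ 16 * (1 + (n + X) / ε) := by
      have : 1 / ε ≤ (n + X) / ε := by gcongr; linarith
      have e : 8 / ε = 8 * (1 / ε) := by ring
      linarith
    have h2 := exp_neg_div_le (t := T₀) τ0 (by positivity : 0 < 8 / ε)
      ((mul_log_le_tildeO (c := 120) (by linarith) hε τ0.le le_rfl (by norm_num)
        (by positivity) hy).trans hT₀)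
    rw [one_div_div] at h2
    linarith
  have hTT : τ ≤ (T : ℝ) - T₀ := by
    have h1 : τ ≤ tildeO 1000 (n + X) ε := by
      have := Real.log_nonneg (by linarith : 1 ≤ 1 + (n + X) / ε)
      rw [tildeO, hτ]
      nlinarith
    linarith
  have hpos : 0 < (T : ℝ) - T₀ := by linarith
  have hle : T₀ ≤ T := by
    have : (T₀ : ℝ) ≤ T := by linarith
    exact_mod_cast this
  have h4 := primal_le_l1Objective_add (x := x) (φ := φ) (σ := σ) hd hε hB hw
  have h5 : ∀ t, (histExp n t fun l => l1Objective x φ σ (p.w (a l)))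
      ≤ (l1Objective x φ σ wstar + ε / 2) + G t := fun t => by
    have h3 := hE t wstar
    have h5 := histExp_mono (n := n) (t := t)
      fun l => l1Objective_le_primal (x := x) (φ := φ) (σ := σ) hd hε hB (p.w (a l))
    linarith
  have h6 := sum_gap_le_of_recursion τ0 hA hrec hle
  have h7 := Finset.sum_le_sum fun t (_ : t ∈ Finset.Ico T₀ T) => h5 t
  rw [Finset.sum_add_distrib, Finset.sum_const, Nat.card_Ico, nsmul_eq_mul, Nat.cast_sub hle] at h7
  rw [div_le_iff₀ hpos]
  -- The window is at least τ long, so the telescoped initial term averages to at most ε/4. The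
  -- total error is at most ε/2 + ε/4 + ε/8.
  have h8 : τ * A T₀ ≤ ((T : ℝ) - T₀) * (ε / 4) :=
    mul_le_mul hTT hAT (hA T₀) hpos.le
  have h9 := mul_le_mul_of_nonneg_left hkτ hpos.le
  have h10 := mul_pos hpos hε
  linarith

end ProxSDCA

/-! ### Conclusion for both loss classes and both outputs -/

theorem mainTheorem4 :
    ∃ C : ℝ, 0 < C ∧
      ∀ (n d : ℕ) (x : Fin n → ProxSDCA.Vec d) (φ : Fin n → ℝ → ℝ) (σ ε B R : ℝ)
        (wstar : ProxSDCA.Vec d),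
        1 ≤ n → 8 ≤ d → 0 < σ → 0 < ε → 0 < B →
        (∀ i, ConvexOn ℝ Set.univ (φ i)) →
        (∀ i a, 0 ≤ φ i a) →
        (1 / (n : ℝ) * ∑ i, φ i 0 ≤ 1) →
        (∀ i, ProxSDCA.linf (x i) ≤ R) →
        IsMinOn (ProxSDCA.l1Objective x φ σ) Set.univ wstar →
        ProxSDCA.l1 wstar ≤ B →
        -- smooth losses
        (∀ γ : ℝ, 0 < γ → (∀ i, ProxSDCA.IsSmooth γ (φ i)) →
          ∀ a : List (Fin n) → Fin n → ℝ,
            ProxSDCA.IsQRun x φ σ ε B R (.smooth γ) a →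
            (∀ T : ℕ,
              ProxSDCA.tildeO C (n + R ^ 2 * B ^ 2 * Real.log d / (ε * γ)) ε ≤ T →
              (ProxSDCA.qProblem x φ σ ε B).expLast (ProxSDCA.l1Objective x φ σ) a T
                ≤ ProxSDCA.l1Objective x φ σ wstar + ε) ∧
            (∀ T₀ T : ℕ,
              ProxSDCA.tildeO C (n + R ^ 2 * B ^ 2 * Real.log d / (ε * γ)) ε ≤ T₀ →
              T₀ < T →
              (ProxSDCA.qProblem x φ σ ε B).expAvg (ProxSDCA.l1Objective x φ σ) a T₀ T
                ≤ ProxSDCA.l1Objective x φ σ wstar + ε ∧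
              (ProxSDCA.qProblem x φ σ ε B).expRandom (ProxSDCA.l1Objective x φ σ) a T₀ T
                ≤ ProxSDCA.l1Objective x φ σ wstar + ε)) ∧
        -- Lipschitz losses
        (∀ L : ℝ, 0 ≤ L → (∀ i, ProxSDCA.IsLip L (φ i)) →
          ∀ a : List (Fin n) → Fin n → ℝ,
            ProxSDCA.IsQRun x φ σ ε B R (.lipschitz L) a →
            ∀ T₀ T : ℕ,
              ProxSDCA.tildeO C (n + L ^ 2 * R ^ 2 * B ^ 2 * Real.log d / ε ^ 2) ε ≤ T₀ →
              T₀ + ProxSDCA.tildeO C (n + L ^ 2 * R ^ 2 * B ^ 2 * Real.log d / ε ^ 2) ε ≤ T →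
              (ProxSDCA.qProblem x φ σ ε B).expAvg (ProxSDCA.l1Objective x φ σ) a T₀ T
                ≤ ProxSDCA.l1Objective x φ σ wstar + ε ∧
              (ProxSDCA.qProblem x φ σ ε B).expRandom (ProxSDCA.l1Objective x φ σ) a T₀ T
                ≤ ProxSDCA.l1Objective x φ σ wstar + ε) := by
  refine ⟨1000, by norm_num, ?_⟩
  intro n d x φ σ ε B R wstar hn hd hσ hε hB hconv hφ hφ0 hR _ hw
  have : NeZero n := ⟨by omega⟩
  have hF := ProxSDCA.convexOn_l1Objective (x := x) hconv hσ.le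
  refine ⟨fun γ hγ hsm a ha => ?_, fun L _ hlip a ha T₀ T hT₀ hT => ?_⟩
  · have key : ∀ t : ℕ,
        ProxSDCA.tildeO 1000 (n + R ^ 2 * B ^ 2 * Real.log d / (ε * γ)) ε ≤ t → _ := fun t ht =>
      ProxSDCA.smooth_iterate_bound hn hd hσ hε hB hconv hφ hφ0 hR hw hγ hsm ha ht
    refine ⟨fun T hT => ?_, fun T₀ T hT₀ hT => ?_⟩
    · rw [ProxSDCA.Problem.expLast_eq]
      exact key T hT
    · have hlt : (T₀ : ℝ) < T := by exact_mod_cast hT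
      have hpos : (0 : ℝ) < (T : ℝ) - T₀ := by linarith
      constructor
      · refine (ProxSDCA.Problem.expAvg_le hF a hT).trans ?_
        rw [div_le_iff₀ hpos]
        refine (Finset.sum_le_card_nsmul _ _ _ fun t ht => key t (hT₀.trans ?_)).trans_eq ?_
        · exact_mod_cast (Finset.mem_Ico.1 ht).1
        · rw [Nat.card_Ico, nsmul_eq_mul, Nat.cast_sub hT.le, mul_comm]
      · rw [ProxSDCA.Problem.expRandom_eq _ _ hT, div_le_iff₀ hpos]
        refine (Finset.sum_le_card_nsmul _ _ _ fun t ht => key t (hT₀.trans ?_)).trans_eq ?_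
        · have := (Finset.mem_Ico.1 ht).1
          exact_mod_cast (by omega : T₀ ≤ t)
        · rw [Nat.card_Ico, nsmul_eq_mul, Nat.add_sub_add_right, Nat.cast_sub hT.le, mul_comm]
  · have hn1 : (1 : ℝ) ≤ n := by exact_mod_cast hn
    have hX : 0 ≤ L ^ 2 * R ^ 2 * B ^ 2 * Real.log d / ε ^ 2 := by
      have := ProxSDCA.two_lt_log hd
      positivity
    have hM : 0 < (n + L ^ 2 * R ^ 2 * B ^ 2 * Real.log d / ε ^ 2) / ε := by positivity
    have hK : 0 < ProxSDCA.tildeO 1000 (n + L ^ 2 * R ^ 2 * B ^ 2 * Real.log d / ε ^ 2) ε := by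
      have := Real.log_nonneg (by linarith :
        1 ≤ 1 + (n + L ^ 2 * R ^ 2 * B ^ 2 * Real.log d / ε ^ 2) / ε)
      rw [ProxSDCA.tildeO]
      positivity
    have hlt : T₀ < T := by
      have : (T₀ : ℝ) < T := by linarith
      exact_mod_cast this
    constructor
    · exact (ProxSDCA.Problem.expAvg_le hF a hlt).trans
        (ProxSDCA.lipschitz_average_bound hn hd hσ hε hB hconv hφ hφ0 hR hw hlip ha hT₀ hT)
    -- The random output ranges over T₀+1, …, T, one index later than the average, so the window is
    -- shifted by one.
    · have h1 := ProxSDCA.lipschitz_average_bound (T₀ := T₀ + 1) (T := T + 1) hn hd hσ hε hB hconv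
        hφ hφ0 hR hw hlip ha (by push_cast; linarith) (by push_cast; linarith)
      rw [ProxSDCA.Problem.expRandom_eq _ _ hlt]
      push_cast at h1
      rwa [add_sub_add_right_eq_sub] at h1
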